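/- Let $\Omega=(0,1)$, $\alpha\in(0,1)$, $T>0$, $a\in C^2([0,1])$ with $a\ge a_0>0$, $q\in L^\infty(\Omega)$ with $q\ge 0$, and $\mathcal{A}v=\partial_x(a\,\partial_x v)-qv$. Let $A$ be the realization of $-\mathcal{A}$ in $L^2(\Omega)$ with domain $D(A)=\{v\in L^2(\Omega):\mathcal{A}v\in L^2(\Omega),\ v'(0)=v(1)=0\}$, let $(\lambda_n,\varphi_n)_{n\ge1}$ be its eigenpairs, with $(\varphi_n)$ orthonormal in $L^2(\Omega)$, and for $r\ge 0$ put $D(A^r)=\{v\in L^2(\Omega):\sum_n\lambda_n^{2r}(v,\varphi_n)^2<\infty\}$. Let $u$ be the solution of $$\partial_t^\alpha u-\mathcal{A}u=f\ \text{ in }\Omega\times(0,T],\quad -a(0)\partial_xu(0,t)=g(t),\quad u(1,t)=0\ \text{ for }t\in(0,T],\quad u(\cdot,0)=u_0\ \text{ in }\Omega,$$ where $f=f(x)$ does not depend on time, $\partial_t^\alpha$ is the Djrbashian--Caputo derivative of order $\alpha$ in time, and the boundary excitation vanishes initially: $g=0$ on $(0,T_1]$ for some $T_1\in(0,T]$.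 (Here $u\in C([0,T];L^2(\Omega))$, $\partial_t^\alpha u\in L^1(0,T;L^2(\Omega))$, and for almost every $t$ one has $u(\cdot,t)\in H^2(\Omega)$ and the equation and the boundary conditions hold.) Suppose $u_0\in D(A^{1+s})$ and $f\in D(A^s)$ with $s\in(\frac14,\frac54]$. Then $u_0\in D(A)$; the functions $u_0$, $\mathcal{A}u_0$, $f$ and $u(\cdot,t)$, $t\in(0,T_1]$, have continuous representatives on $[0,1]$; and $h(t)=u(0,t)$ satisfies, for every $\epsilon\in(0,s-\frac14)$, $$h(t)=u_0(0)+\frac{\mathcal{A}u_0(0)+f(0)}{\Gamma(1+\alpha)}\,t^\alpha+O\big(t^{(1-\frac14-\frac{\epsilon}{2}+s)\alpha}\big)\qquad\text{as }t\to0^+ .$$ -/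

import Mathlib

open MeasureTheory Set Filter Topology Asymptotics

noncomputable section

namespace Subdiffusion

/-- The real Hilbert space `L²(Ω)`, with `Ω = (0,1)`. -/
abbrev L2 : Type := Lp ℝ 2 ((volume : Measure ℝ).restrict (Ioo (0 : ℝ) 1))

/-- `V` is a representative of `v ∈ L²(Ω)`. -/
def Represents (V : ℝ → ℝ) (v : L2) : Prop :=
  ∀ᵐ x ∂((volume : Measure ℝ).restrict (Ioo (0 : ℝ) 1)), v x = V x

/-- The class `v ∈ L²(Ω)` has a representative that is continuous on `[0,1]`, and the value of
that (unique) continuous representative at the left end point is `c`; in short, `v(0) = c`. -/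
def HasValueAtZero (v : L2) (c : ℝ) : Prop :=
  ∃ V : ℝ → ℝ, ContinuousOn V (Icc 0 1) ∧ Represents V v ∧ V 0 = c

/-- `𝒜V = ∂ₓ(a ∂ₓV) - qV = w` with `w ∈ L²(Ω)`, for the continuous representative `V` of an
`H²(Ω)`-function and `V' = ∂ₓV`: the function `V` is `C¹` on `[0,1]`, and the flux `aV'` is
absolutely continuous with `(aV')' = w + qV` almost everywhere. -/
structure EllipticImage (a q V V' : ℝ → ℝ) (w : L2) : Prop where
  hasDeriv : ∀ x ∈ Icc (0 : ℝ) 1, HasDerivWithinAt V (V' x) (Icc 0 1) x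
  flux : ∀ x ∈ Icc (0 : ℝ) 1,
    a x * V' x = a 0 * V' 0 + ∫ y in (0 : ℝ)..x, (w y + q y * V y)

/-- The graph of the operator `A`, the realization of `-𝒜` in `L²(Ω)` with domain
`D(A) = {v ∈ L²(Ω) : 𝒜v ∈ L²(Ω), v'(0) = v(1) = 0}`:
`OperatorA a q v w` says that `v ∈ D(A)` and `Av = w`. -/
def OperatorA (a q : ℝ → ℝ) (v w : L2) : Prop :=
  ∃ V V' : ℝ → ℝ, Represents V v ∧ EllipticImage a q V V' (-w) ∧ V' 0 = 0 ∧ V 1 = 0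

/-- The eigenspace of `A` at `lam` (it is `{0}` unless `lam` is an eigenvalue). The solutions of
`Aφ = lam φ` form a closed linear subspace already; span and closure only make this formal. -/
def eigenspace (a q : ℝ → ℝ) (lam : ℝ) : Submodule ℝ L2 :=
  (Submodule.span ℝ {φ : L2 | OperatorA a q φ (lam • φ)}).topologicalClosure

instance (a q : ℝ → ℝ) (lam : ℝ) : (eigenspace a q lam).HasOrthogonalProjection :=
  inferInstanceAs
    ((Submodule.span ℝ {φ : L2 | OperatorA a q φ (lam • φ)}).topologicalClosure).HasOrthogonalProjection

/-- The domain `D(Aˢ)` of the fractional power `Aˢ v = ∑ₙ λₙˢ (v, φₙ) φₙ`, that is, the set of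
`v ∈ L²(Ω)` with `∑ₙ λₙ²ˢ (v, φₙ)² < ∞`. The terms are grouped by eigenvalues: the sum of
`(v, φₙ)²` over the `n` with `λₙ = lam` is the squared norm of the orthogonal projection of `v` onto
the eigenspace at `lam`, and that projection vanishes when `lam` is not an eigenvalue. -/
def fracDomain (a q : ℝ → ℝ) (s : ℝ) : Set L2 :=
  {v | Summable fun lam : ℝ => lam ^ (2 * s) * ‖(eigenspace a q lam).starProjection v‖ ^ 2}

/-- `w = ∂ₜ^α u` on `(0,T)` for the Djrbashian-Caputo derivative of order `α ∈ (0,1)` of a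
continuous function `u` on `[0,T]`, in the form `∂ₜ^α u = d/dt I^{1-α}(u - u(0))` with the
Riemann-Liouville integral `I^{1-α}`, where `d/dt` is the derivative of an absolutely
continuous function. For absolutely continuous `u` this is
`(1/Γ(1-α)) ∫₀ᵗ (t-s)^{-α} u'(s) ds`, see `HasCaputoDeriv.of_deriv`. -/
def HasCaputoDeriv {E : Type*} [NormedAddCommGroup E] [NormedSpace ℝ E]
    (α T : ℝ) (u w : ℝ → E) : Prop :=
  IntegrableOn w (Ioc 0 T) ∧
    ∀ t ∈ Icc (0 : ℝ) T,
      (Real.Gamma (1 - α))⁻¹ • ∫ s in (0 : ℝ)..t, (t - s) ^ (-α) • (u s - u 0)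
        = ∫ s in (0 : ℝ)..t, w s

/-- For an absolutely continuous `u`, with derivative `u'`, the Djrbashian-Caputo derivative is
`(1/Γ(1-α)) ∫₀ᵗ (t-s)^{-α} u'(s) ds`. -/
theorem HasCaputoDeriv.of_deriv {E : Type*} [NormedAddCommGroup E] [NormedSpace ℝ E]
    [CompleteSpace E] {α T : ℝ} (hα : α < 1) {u u' : ℝ → E}
    (hu' : IntegrableOn u' (Ioc 0 T)) (hu : ∀ t ∈ Icc (0 : ℝ) T, u t = u 0 + ∫ r in (0 : ℝ)..t, u' r) :
    HasCaputoDeriv α T u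
      (fun t => (Real.Gamma (1 - α))⁻¹ • ∫ s in (0 : ℝ)..t, (t - s) ^ (-α) • u' s) := by
  have hk : ∀ t : ℝ, IntegrableOn (fun x : ℝ => x ^ (-α)) (Ioc 0 t) := fun t => by
    by_cases ht : 0 ≤ t
    · exact (intervalIntegrable_iff_integrableOn_Ioc_of_le ht).1
        (intervalIntegral.intervalIntegrable_rpow' (by linarith [hα]))
    · simp [Ioc_eq_empty (by linarith : ¬ (0:ℝ) < t)]
  -- the kernel of the convolution, extended by zero
  set k : ℝ → ℝ := (Ioc 0 T).indicator fun x => x ^ (-α) with hkdef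
  set v : ℝ → E := (Ioc 0 T).indicator u' with hvdef
  have hkI : Integrable k := (hk T).integrable_indicator measurableSet_Ioc
  have hvI : Integrable v := hu'.integrable_indicator measurableSet_Ioc
  have hconv : Integrable (fun p : ℝ × ℝ => k (p.1 - p.2) • v p.2)
      ((volume : Measure ℝ).prod volume) := by
    have := hvI.convolution_integrand (ContinuousLinearMap.lsmul ℝ ℝ (E := E)).flip hkI
    simpa using this
  have hrep : ∀ s ∈ Icc (0 : ℝ) T, ∫ r in (0 : ℝ)..s, (s - r) ^ (-α) • u' r
      = ∫ r, k (s - r) • v r := by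
    intro s hs
    rw [intervalIntegral.integral_of_le hs.1, integral_Ioc_eq_integral_Ioo,
      ← integral_indicator measurableSet_Ioo]
    congr 1
    ext r
    by_cases hr : r ∈ Ioo 0 s
    · have h1 : s - r ∈ Ioc 0 T := ⟨by linarith [hr.2], by linarith [hr.1, hs.2]⟩
      have h2 : r ∈ Ioc 0 T := ⟨hr.1, by linarith [hr.2, hs.2]⟩
      simp [hkdef, hvdef, hr, h1, h2]
    · rw [indicator_of_notMem hr]
      by_cases h2 : r ∈ Ioc 0 T
      · have h1 : s - r ∉ Ioc 0 T := fun h => hr ⟨h2.1, by linarith [h.1]⟩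
        rw [hkdef, indicator_of_notMem h1, zero_smul]
      · rw [hvdef, indicator_of_notMem h2, smul_zero]
  refine ⟨?_, fun t ht => ?_⟩
  · refine Integrable.smul _ ?_
    refine (hconv.integral_prod_left.integrableOn (s := Ioc 0 T)).congr ?_
    filter_upwards [ae_restrict_mem measurableSet_Ioc] with s hs
    exact (hrep s ⟨hs.1.le, hs.2⟩).symm
  rw [intervalIntegral.integral_smul]
  congr 1
  -- both sides equal `∫ r in 0..t, (∫ x in 0..(t - r), x ^ (-α)) • u' r`
  have hu't : IntegrableOn u' (Ioc 0 t) := hu'.mono_set (Ioc_subset_Ioc_right ht.2)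
  have hkt : IntegrableOn (fun s : ℝ => (t - s) ^ (-α)) (Ioc 0 t) := by
    have h1 := (intervalIntegrable_iff_integrableOn_Ioc_of_le ht.1).2 (hk t)
    have h2 := (h1.comp_sub_left t).symm
    simp only [sub_self, sub_zero] at h2
    exact (intervalIntegrable_iff_integrableOn_Ioc_of_le ht.1).1 h2
  have hL : ∫ s in (0 : ℝ)..t, (t - s) ^ (-α) • (u s - u 0)
      = ∫ r in Ioc 0 t, (∫ x in (0 : ℝ)..(t - r), x ^ (-α)) • u' r := by
    have e1 : ∫ s in (0 : ℝ)..t, (t - s) ^ (-α) • (u s - u 0)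
        = ∫ s in Ioc 0 t, ∫ r in Ioc 0 t, {p : ℝ × ℝ | p.2 ≤ p.1}.indicator
            (fun p : ℝ × ℝ => (t - p.1) ^ (-α) • u' p.2) (s, r) := by
      rw [intervalIntegral.integral_of_le ht.1]
      refine setIntegral_congr_fun measurableSet_Ioc fun s hs => ?_
      have : u s - u 0 = ∫ r in Ioc 0 t, (Iic s).indicator u' r := by
        rw [hu s ⟨hs.1.le, hs.2.trans ht.2⟩, add_sub_cancel_left,
          intervalIntegral.integral_of_le hs.1.le, setIntegral_indicator measurableSet_Iic]
        congr 2
        ext r; simp only [mem_Ioc, mem_inter_iff, mem_Iic]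
        constructor
        · rintro ⟨h1, h2⟩; exact ⟨⟨h1, h2.trans hs.2⟩, h2⟩
        · rintro ⟨⟨h1, _⟩, h2⟩; exact ⟨h1, h2⟩
      show (t - s) ^ (-α) • (u s - u 0) = _
      rw [this, ← integral_smul]
      refine integral_congr_ae (Eventually.of_forall fun r => ?_)
      by_cases h : r ≤ s <;> simp [indicator, h]
    rw [e1, integral_integral_swap]
    · refine setIntegral_congr_fun measurableSet_Ioc fun r hr => ?_
      have e2 : (∫ x in (0 : ℝ)..(t - r), x ^ (-α)) = ∫ s in Ioc 0 t, (Ici r).indicator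
          (fun s => (t - s) ^ (-α)) s := by
        rw [setIntegral_indicator measurableSet_Ici]
        have : Ioc 0 t ∩ Ici r = Icc r t := by
          ext x; simp only [mem_Ioc, mem_inter_iff, mem_Ici, mem_Icc]
          constructor
          · rintro ⟨⟨_, h1⟩, h2⟩; exact ⟨h2, h1⟩
          · rintro ⟨h1, h2⟩; exact ⟨⟨hr.1.trans_le h1, h2⟩, h1⟩
        rw [this, integral_Icc_eq_integral_Ioc, ← intervalIntegral.integral_of_le hr.2,
          intervalIntegral.integral_comp_sub_left (fun x : ℝ => x ^ (-α)), sub_self]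
      show _ = (∫ x in (0 : ℝ)..(t - r), x ^ (-α)) • u' r
      rw [e2, ← integral_smul_const]
      refine integral_congr_ae (Eventually.of_forall fun s => ?_)
      by_cases h : r ≤ s <;> simp [indicator, h]
    · exact (hkt.integrable.smul_prod hu't.integrable).indicator
        (measurableSet_le measurable_snd measurable_fst)
  have hR : ∫ s in (0 : ℝ)..t, ∫ r in (0 : ℝ)..s, (s - r) ^ (-α) • u' r
      = ∫ r in Ioc 0 t, (∫ x in (0 : ℝ)..(t - r), x ^ (-α)) • u' r := by
    have e1 : ∫ s in (0 : ℝ)..t, ∫ r in (0 : ℝ)..s, (s - r) ^ (-α) • u' r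
        = ∫ s in Ioc 0 t, ∫ r, k (s - r) • v r := by
      rw [intervalIntegral.integral_of_le ht.1]
      exact setIntegral_congr_fun measurableSet_Ioc fun s hs =>
        hrep s ⟨hs.1.le, hs.2.trans ht.2⟩
    rw [e1, integral_integral_swap]
    · rw [← integral_indicator measurableSet_Ioc]
      refine integral_congr_ae (Eventually.of_forall fun r => ?_)
      show ∫ s in Ioc 0 t, k (s - r) • v r = _
      rw [integral_smul_const]
      by_cases hr : r ∈ Ioc 0 t
      · rw [indicator_of_mem hr]
        have hv : v r = u' r := indicator_of_mem (Ioc_subset_Ioc_right ht.2 hr) _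
        rw [hv]
        congr 1
        have e3 : ∀ s ∈ Ioc 0 t, k (s - r) = (Ioc r t).indicator (fun s => (s - r) ^ (-α)) s := by
          intro s hs
          by_cases h : r < s
          · have h1 : s - r ∈ Ioc 0 T := ⟨by linarith, by linarith [hs.2, hr.1, ht.2]⟩
            have h2 : s ∈ Ioc r t := ⟨h, hs.2⟩
            rw [hkdef, indicator_of_mem h1, indicator_of_mem h2]
          · have h1 : s - r ∉ Ioc 0 T := fun h' => h (by linarith [h'.1])
            have h2 : s ∉ Ioc r t := fun h' => h h'.1
            rw [hkdef, indicator_of_notMem h1, indicator_of_notMem h2]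
        rw [setIntegral_congr_fun measurableSet_Ioc e3, setIntegral_indicator measurableSet_Ioc,
          inter_eq_right.2 (Ioc_subset_Ioc_left hr.1.le), ← intervalIntegral.integral_of_le hr.2,
          intervalIntegral.integral_comp_sub_right (fun x : ℝ => x ^ (-α)), sub_self]
      · rw [indicator_of_notMem hr]
        by_cases h0 : r ∈ Ioc 0 T
        · have hrt : t < r := by
            by_contra h
            exact hr ⟨h0.1, not_lt.1 h⟩
          have : ∀ s ∈ Ioc 0 t, k (s - r) = 0 := fun s hs =>
            indicator_of_notMem (fun h => by linarith [h.1, hs.2]) _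
          rw [setIntegral_congr_fun measurableSet_Ioc this]
          simp
        · rw [hvdef, indicator_of_notMem h0, smul_zero]
    · refine hconv.mono_measure ?_
      exact Measure.prod_mono Measure.restrict_le_self le_rfl
  rw [hL, hR]

/-- `u` (with `u t = u(·,t)`) is a solution of the initial boundary value problem
`∂ₜ^α u - 𝒜u = f` in `Ω × (0,T]`, `-a(0)∂ₓu(0,t) = g(t)` and `u(1,t) = 0` in `(0,T]`,
`u(0) = u₀` in `Ω`: it is continuous on `[0,T]` with values in `L²(Ω)`, it has an integrable
Djrbashian-Caputo derivative, and for almost every `t` it lies in `H²(Ω)` and satisfies the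
equation and the boundary conditions. -/
structure IsSolution (a q : ℝ → ℝ) (α T : ℝ) (g : ℝ → ℝ) (f u₀ : L2) (u : ℝ → L2) : Prop where
  continuousOn : ContinuousOn u (Icc 0 T)
  initial : u 0 = u₀
  equation : ∃ w : ℝ → L2, HasCaputoDeriv α T u w ∧
    ∀ᵐ t ∂((volume : Measure ℝ).restrict (Ioc 0 T)), ∃ V V' : ℝ → ℝ,
      Represents V (u t) ∧ EllipticImage a q V V' (w t - f) ∧ -(a 0 * V' 0) = g t ∧ V 1 = 0

end Subdiffusion

end

/-!
With `J p (x) = ∫₁ˣ p`, a function `v` with `v(1) = 0` is `J v'`, and `J† w (x) = -∫₀ˣ w`. In terms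
of `p = v'` the problem `Av = w`, with the natural boundary condition `v'(0) = 0`, becomes
`(M_a + J† M_q J) p = J† w`, and the operator on the left is coercive (`le_inner_energyOp`). So `A` is
the inverse of the compact, symmetric, injective operator `K = J (M_a + J† M_q J)⁻¹ J†`
(`operatorA_iff`), and the spectral theorem shows that the eigenfunctions of `A` are complete. The
domain of `A` need not be described by Sobolev spaces.

Point values are controlled by the inequality `V(x)² ≤ 2 ‖V‖ ‖V'‖`. Together with
`a₀ ‖V'‖² ≤ (AV, V)` it bounds the maximum of a function with spectrum in `[Λ, 2Λ)` by `Λ^{1/4}` times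
its `L²`-norm up to a constant. The sum over the dyadic blocks of the spectrum is a geometric series
as soon as `σ > 1/4`, which gives the embedding of `D(A^σ)` into the continuous functions
(`exists_continuous_rep`); neither the asymptotics of the eigenvalues nor uniform bounds of the
eigenfunctions enter.

While `g = 0`, the coefficient `y = (u - u₀, φ)` for `Aφ = λφ` solves `∂ₜ^α y + λ y = r`, `y(0) = 0`,
with `r = (f - A u₀, φ)` (`modal_equation`). Abel inversion turns this into `y = I^α z`,
`z = r - λ y`, a Volterra equation for `z` with a decreasing, log-convex kernel, and a first-zero
argument shows that `z` lies between `0` and `r` (`volterra_bounds`). Therefore the deviation of `y`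
from `r t^α / Γ(1+α)` is at most `|r| t^α / Γ(1+α)` times `min(1, X) ≤ X^θ`, where
`X = λ t^α / Γ(1+α)` (`mode_estimate`). This replaces estimates of Mittag-Leffler functions. For
`θ = s - 1/4 - ε/2` and `σ = 1/4 + ε/2` one has `σ + θ = s`, so the remainder is
`O(t^{α(1+θ)})` in `D(A^σ)`, and the embedding gives the expansion at `x = 0`.
-/

namespace Subdiffusion

/-! ### The Abel kernel and a Volterra equation -/

theorem intervalIntegrable_sub_rpow {β : ℝ} (hβ : -1 < β) (t a b : ℝ) :
    IntervalIntegrable (fun s : ℝ => (t - s) ^ β) volume a b := by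
  have h := (intervalIntegral.intervalIntegrable_rpow' (a := t - a) (b := t - b) hβ).comp_sub_left t
  simpa using h

theorem integral_sub_rpow {β : ℝ} (hβ : -1 < β) (a t : ℝ) :
    ∫ s in a..t, (t - s) ^ β = (t - a) ^ (β + 1) / (β + 1) := by
  rw [intervalIntegral.integral_comp_sub_left (fun x : ℝ => x ^ β), sub_self,
    integral_rpow (Or.inl hβ), Real.zero_rpow (by linarith), sub_zero]

theorem intervalIntegrable_sub_rpow_mul {β : ℝ} (hβ : -1 < β) (t : ℝ) {a b : ℝ} {z : ℝ → ℝ}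
    (hz : ContinuousOn z (uIcc a b)) :
    IntervalIntegrable (fun s : ℝ => (t - s) ^ β * z s) volume a b :=
  (intervalIntegrable_sub_rpow hβ t a b).mul_continuousOn hz

/-- If `|z| ≤ M` on `[a,t]`, the Abel integral of `z` over `[a,t]` is at most `M (t-a)^α / α`. -/
theorem abs_integral_sub_rpow_mul_le {α : ℝ} (hα : 0 < α) {a t : ℝ} (hat : a ≤ t) {z : ℝ → ℝ}
    (hz : ContinuousOn z (Icc a t)) {M : ℝ} (hM : ∀ s ∈ Icc a t, |z s| ≤ M) :
    |∫ s in a..t, (t - s) ^ (α - 1) * z s| ≤ M * ((t - a) ^ α / α) := by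
  have h1 := integral_sub_rpow (β := α - 1) (by linarith) a t
  rw [sub_add_cancel] at h1
  rw [← h1, ← intervalIntegral.integral_const_mul]
  refine (intervalIntegral.abs_integral_le_integral_abs hat).trans ?_
  refine intervalIntegral.integral_mono_on hat ?_ ?_ fun s hs => ?_
  · exact (intervalIntegrable_sub_rpow_mul (by linarith) t (by rwa [uIcc_of_le hat])).abs
  · exact (intervalIntegrable_sub_rpow (by linarith) t a t).const_mul M
  · have h2 : 0 ≤ (t - s) ^ (α - 1) := Real.rpow_nonneg (by linarith [hs.2]) _
    rw [abs_mul, abs_of_nonneg h2, mul_comm]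
    exact mul_le_mul_of_nonneg_right (hM s hs) h2

/-- A step length on which the Abel integral is a contraction. -/
theorem exists_small_step {α : ℝ} (hα : 0 < α) (c : ℝ) {b : ℝ} (hb : 0 < b) :
    ∃ δ > 0, δ ≤ b ∧ ∀ x ∈ Icc 0 δ, |c| * (x ^ α / α) ≤ 1 / 4 := by
  have h1 : Continuous fun x : ℝ => |c| * (x ^ α / α) := by
    have := Real.continuous_rpow_const hα.le
    fun_prop
  have h2 : ∀ᶠ x in 𝓝 (0 : ℝ), |c| * (x ^ α / α) < 1 / 4 := by
    refine h1.continuousAt.eventually_lt continuousAt_const ?_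
    simp [Real.zero_rpow hα.ne']
  obtain ⟨δ, hδ, h3⟩ := Metric.eventually_nhds_iff.1 h2
  refine ⟨min (δ / 2) b, lt_min (by linarith) hb, min_le_right _ _, fun x hx => (h3 ?_).le⟩
  rw [Real.dist_eq, sub_zero, abs_of_nonneg hx.1]
  linarith [hx.2.trans (min_le_left _ _)]

/-- Positivity of the solution of `z(t) = 1 - c ∫₀ᵗ (t-s)^{α-1} z(s) ds`, `c ≥ 0`. The kernel is
decreasing and log-convex, and these two properties exclude a first zero of `z`. -/
theorem volterra_pos {α : ℝ} (hα : α ∈ Ioo (0 : ℝ) 1) {c T : ℝ} (hc : 0 ≤ c) {z : ℝ → ℝ}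
    (hz : ContinuousOn z (Icc 0 T))
    (heq : ∀ t ∈ Icc 0 T, z t = 1 - c * ∫ s in (0 : ℝ)..t, (t - s) ^ (α - 1) * z s) :
    ∀ t ∈ Icc 0 T, 0 < z t := by
  by_contra! hcon
  obtain ⟨t₁, ht₁, hzt₁⟩ := hcon
  have hβ : -1 < α - 1 := by linarith [hα.1]
  set S : Set ℝ := Icc 0 T ∩ z ⁻¹' Iic 0 with hS
  have hScl : IsClosed S := hz.preimage_isClosed_of_isClosed isClosed_Icc isClosed_Iic
  have hSne : S.Nonempty := ⟨t₁, ht₁, hzt₁⟩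
  have hSbdd : BddBelow S := ⟨0, fun x hx => hx.1.1⟩
  -- the first zero
  obtain ⟨⟨h0, hT⟩, hzt0⟩ : sInf S ∈ S := hScl.csInf_mem hSne hSbdd
  set t₀ := sInf S with ht₀
  have hbefore : ∀ x ∈ Ico 0 t₀, 0 < z x := by
    intro x hx
    by_contra! h
    exact absurd (csInf_le hSbdd (⟨⟨hx.1, hx.2.le.trans hT⟩, h⟩ : x ∈ S)) (not_le.2 hx.2)
  have hz0 : z 0 = 1 := by
    have := heq 0 ⟨le_rfl, h0.trans hT⟩
    simpa using this
  have ht₀pos : 0 < t₀ := by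
    rcases h0.lt_or_eq with h | h
    · exact h
    · rw [← h] at hzt0
      have : z 0 ≤ 0 := hzt0
      linarith
  obtain ⟨δ, hδ, hδt, hδc⟩ := exists_small_step hα.1 c (half_pos ht₀pos)
  -- comparing `t₀` with the maximum point `t` of `z` on `[t₀ - δ, t₀]` lets `z t` absorb the singular
  -- part of the kernel
  obtain ⟨t, ht, htmax⟩ := isCompact_Icc.exists_isMaxOn (nonempty_Icc.2 (by linarith : t₀ - δ ≤ t₀))
    (hz.mono (Icc_subset_Icc (by linarith) hT))
  have hzt : 0 < z t :=
    (hbefore (t₀ - δ) ⟨by linarith, by linarith⟩).trans_le (htmax ⟨le_rfl, by linarith⟩)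
  have htt₀ : t < t₀ := by
    rcases ht.2.lt_or_eq with h | h
    · exact h
    · rw [h] at hzt
      exact absurd hzt (not_lt.2 hzt0)
  have htpos : 0 < t := by linarith [ht.1]
  set ρ : ℝ := (t / t₀) ^ (1 - α) with hρ
  have hr1 : t / t₀ < 1 := (div_lt_one ht₀pos).2 htt₀
  have hr2 : 1 / 2 ≤ t / t₀ := by rw [le_div_iff₀ ht₀pos]; linarith [ht.1]
  have hρ1 : ρ < 1 := Real.rpow_lt_one (by linarith) hr1 (by linarith [hα.2])
  have hρ2 : 1 / 2 ≤ ρ := by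
    refine hr2.trans ?_
    have := Real.rpow_le_rpow_of_exponent_ge (by linarith : 0 < t / t₀) hr1.le
      (by linarith [hα.1] : 1 - α ≤ 1)
    rwa [Real.rpow_one] at this
  have hzc : ∀ {x y : ℝ}, 0 ≤ x → y ≤ T → x ≤ y → ContinuousOn z (uIcc x y) := by
    intro x y hx hy hxy
    rw [uIcc_of_le hxy]
    exact hz.mono (Icc_subset_Icc hx hy)
  -- log-convexity of the kernel compares the history up to `t` as seen from `t₀` and from `t`
  have hker : ∀ s ∈ Ico 0 t, (t₀ - s) ^ (α - 1) ≤ ρ * (t - s) ^ (α - 1) := by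
    intro s hs
    have hts : 0 < t - s := by linarith [hs.2]
    have hts0 : 0 < t₀ - s := by linarith
    have h1 : (t - s) / (t₀ - s) ≤ t / t₀ := by
      rw [div_le_div_iff₀ hts0 ht₀pos]; nlinarith [hs.1]
    have h2 : ((t - s) / (t₀ - s)) ^ (1 - α) ≤ ρ :=
      Real.rpow_le_rpow (by positivity) h1 (by linarith [hα.2])
    have h3 : (t₀ - s) ^ (α - 1) = ((t - s) / (t₀ - s)) ^ (1 - α) * (t - s) ^ (α - 1) := by
      rw [Real.div_rpow hts.le hts0.le, show α - 1 = -(1 - α) by ring, Real.rpow_neg hts0.le,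
        Real.rpow_neg hts.le]
      have := (Real.rpow_pos_of_pos hts (1 - α)).ne'
      field_simp
    rw [h3]
    exact mul_le_mul_of_nonneg_right h2 (Real.rpow_nonneg hts.le _)
  have hA : ∫ s in (0 : ℝ)..t, (t₀ - s) ^ (α - 1) * z s
      ≤ ρ * ∫ s in (0 : ℝ)..t, (t - s) ^ (α - 1) * z s := by
    rw [← intervalIntegral.integral_const_mul]
    refine intervalIntegral.integral_mono_on_of_le_Ioo htpos.le
      (intervalIntegrable_sub_rpow_mul hβ t₀ (hzc le_rfl (by linarith) htpos.le))
      ((intervalIntegrable_sub_rpow_mul hβ t (hzc le_rfl (by linarith) htpos.le)).const_mul ρ) ?_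
    intro s hs
    rw [← mul_assoc]
    exact mul_le_mul_of_nonneg_right (hker s ⟨hs.1.le, hs.2⟩) (hbefore s ⟨hs.1.le, hs.2.trans htt₀⟩).le
  have hB : ∫ s in t..t₀, (t₀ - s) ^ (α - 1) * z s ≤ z t * ((t₀ - t) ^ α / α) := by
    have h1 := integral_sub_rpow hβ t t₀
    rw [sub_add_cancel] at h1
    rw [← h1, ← intervalIntegral.integral_const_mul]
    refine intervalIntegral.integral_mono_on htt₀.le
      (intervalIntegrable_sub_rpow_mul hβ t₀ (hzc htpos.le hT htt₀.le))
      ((intervalIntegrable_sub_rpow hβ t₀ t t₀).const_mul _) fun s hs => ?_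
    rw [mul_comm]
    exact mul_le_mul_of_nonneg_right (htmax ⟨ht.1.trans hs.1, hs.2⟩)
      (Real.rpow_nonneg (by linarith [hs.2]) _)
  have hsplit := intervalIntegral.integral_add_adjacent_intervals
    (intervalIntegrable_sub_rpow_mul hβ t₀ (hzc le_rfl (by linarith) htpos.le))
    (intervalIntegrable_sub_rpow_mul hβ t₀ (hzc htpos.le hT htt₀.le))
  have e0 := heq t₀ ⟨h0, hT⟩
  have e1 := heq t ⟨htpos.le, by linarith⟩
  rw [← hsplit] at e0
  have hsm := hδc (t₀ - t) ⟨by linarith, by linarith [ht.1]⟩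
  rw [abs_of_nonneg hc] at hsm
  have hA' := mul_le_mul_of_nonneg_left hA hc
  have hB' := mul_le_mul_of_nonneg_left hB hc
  have hz0' : z t₀ ≤ 0 := hzt0
  have k1 := mul_le_mul_of_nonneg_right hsm hzt.le
  have k2 := mul_le_mul_of_nonneg_right hρ2 hzt.le
  have k3 : ρ * (c * ∫ s in (0 : ℝ)..t, (t - s) ^ (α - 1) * z s) = ρ * (1 - z t) := by
    rw [e1]; ring
  nlinarith

theorem volterra_eq_zero {α : ℝ} (hα : 0 < α) {c T : ℝ} {z : ℝ → ℝ}
    (hz : ContinuousOn z (Icc 0 T))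
    (heq : ∀ t ∈ Icc 0 T, z t = -c * ∫ s in (0 : ℝ)..t, (t - s) ^ (α - 1) * z s) :
    ∀ t ∈ Icc 0 T, z t = 0 := by
  by_contra! hcon
  obtain ⟨t₁, ht₁, hzt₁⟩ := hcon
  have hβ : -1 < α - 1 := by linarith
  set S : Set ℝ := {t ∈ Icc 0 T | z t ≠ 0} with hS
  have hSne : S.Nonempty := ⟨t₁, ht₁, hzt₁⟩
  have hSbdd : BddBelow S := ⟨0, fun x hx => hx.1.1⟩
  set t₀ := sInf S with ht₀
  have h0 : 0 ≤ t₀ := le_csInf hSne fun x hx => hx.1.1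
  have hT : t₀ ≤ T := (csInf_le hSbdd ⟨ht₁, hzt₁⟩).trans ht₁.2
  have hbefore : ∀ x ∈ Ico 0 t₀, z x = 0 := by
    intro x hx
    by_contra h
    exact absurd (csInf_le hSbdd (⟨⟨hx.1, hx.2.le.trans hT⟩, h⟩ : x ∈ S)) (not_le.2 hx.2)
  obtain ⟨δ, hδ, -, hδc⟩ := exists_small_step hα c one_pos
  set b := min (t₀ + δ) T with hb
  have hbt : t₀ ≤ b := le_min (by linarith) hT
  have hcont : ContinuousOn z (Icc t₀ b) := hz.mono (Icc_subset_Icc h0 (min_le_right _ _))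
  obtain ⟨t, ht, htmax⟩ := isCompact_Icc.exists_isMaxOn (nonempty_Icc.2 hbt) hcont.abs
  have hzt : z t = 0 := by
    have e := heq t ⟨h0.trans ht.1, ht.2.trans (min_le_right _ _)⟩
    have hzc : ∀ {x y : ℝ}, 0 ≤ x → y ≤ T → x ≤ y → ContinuousOn z (uIcc x y) := by
      intro x y hx hy hxy
      rw [uIcc_of_le hxy]
      exact hz.mono (Icc_subset_Icc hx hy)
    have htT : t ≤ T := ht.2.trans (min_le_right _ _)
    have hsplit := intervalIntegral.integral_add_adjacent_intervals
      (intervalIntegrable_sub_rpow_mul hβ t (hzc le_rfl hT h0))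
      (intervalIntegrable_sub_rpow_mul hβ t (hzc h0 htT ht.1))
    have hfirst : ∫ s in (0 : ℝ)..t₀, (t - s) ^ (α - 1) * z s = 0 := by
      rw [intervalIntegral.integral_of_le h0, integral_Ioc_eq_integral_Ioo]
      refine setIntegral_eq_zero_of_forall_eq_zero fun s hs => ?_
      rw [hbefore s ⟨hs.1.le, hs.2⟩, mul_zero]
    rw [hfirst, zero_add] at hsplit
    rw [← hsplit] at e
    have h1 := abs_integral_sub_rpow_mul_le hα ht.1 (hcont.mono (Icc_subset_Icc_right ht.2))
      (M := |z t|) fun s hs => htmax ⟨hs.1, hs.2.trans ht.2⟩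
    have h2 : |z t| ≤ |c| * (|z t| * ((t - t₀) ^ α / α)) := by
      conv_lhs => rw [e]
      rw [abs_mul, abs_neg]
      exact mul_le_mul_of_nonneg_left h1 (abs_nonneg c)
    have h3 := hδc (t - t₀) ⟨by linarith [ht.1], by linarith [ht.2.trans (min_le_left _ _)]⟩
    have h4 := mul_le_mul_of_nonneg_left h3 (abs_nonneg (z t))
    have : |z t| ≤ 0 := by nlinarith [abs_nonneg (z t)]
    exact abs_eq_zero.1 (le_antisymm this (abs_nonneg _))
  have hzero : ∀ s ∈ Icc 0 b, z s = 0 := by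
    intro s hs
    rcases lt_or_ge s t₀ with h | h
    · exact hbefore s ⟨hs.1, h⟩
    · have h5 : |z s| ≤ |z t| := htmax ⟨h, hs.2⟩
      rw [hzt, abs_zero] at h5
      exact abs_eq_zero.1 (le_antisymm h5 (abs_nonneg _))
  obtain ⟨x, hx, hxlt⟩ := exists_lt_of_csInf_lt hSne (show sInf S < t₀ + δ by linarith)
  have hxb : x ≤ b := le_min hxlt.le hx.1.2
  exact hx.2 (hzero x ⟨hx.1.1, hxb⟩)

/-- The solution of `z(t) = r - c ∫₀ᵗ (t-s)^{α-1} z(s) ds` with `c ≥ 0` lies between `0` and `r`. -/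
theorem volterra_bounds {α : ℝ} (hα : α ∈ Ioo (0 : ℝ) 1) {c r T : ℝ} (hc : 0 ≤ c) {z : ℝ → ℝ}
    (hz : ContinuousOn z (Icc 0 T))
    (heq : ∀ t ∈ Icc 0 T, z t = r - c * ∫ s in (0 : ℝ)..t, (t - s) ^ (α - 1) * z s) :
    ∀ t ∈ Icc 0 T, |z t| ≤ |r| ∧ |z t - r| ≤ |r| := by
  intro t ht
  rcases eq_or_ne r 0 with rfl | hr
  · have := volterra_eq_zero hα.1 (c := c) hz (fun t ht => by rw [heq t ht]; ring) t ht
    simp [this]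
  have heq' : ∀ t ∈ Icc 0 T,
      z t / r = 1 - c * ∫ s in (0 : ℝ)..t, (t - s) ^ (α - 1) * (z s / r) := by
    intro t ht
    have h1 : ∫ s in (0 : ℝ)..t, (t - s) ^ (α - 1) * (z s / r)
        = (∫ s in (0 : ℝ)..t, (t - s) ^ (α - 1) * z s) / r := by
      rw [← intervalIntegral.integral_div]
      congr 1; ext s; ring
    rw [h1]
    conv_lhs => rw [heq t ht]
    field_simp
  have hpos := volterra_pos hα hc (hz.div_const r) heq'
  have h0 := hpos t ht
  have h1 : z t / r ≤ 1 := by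
    rw [heq' t ht]
    have : 0 ≤ ∫ s in (0 : ℝ)..t, (t - s) ^ (α - 1) * (z s / r) :=
      intervalIntegral.integral_nonneg ht.1 fun s hs =>
        mul_nonneg (Real.rpow_nonneg (by linarith [hs.2]) _)
          (hpos s ⟨hs.1, hs.2.trans ht.2⟩).le
    nlinarith
  have hzr : z t = z t / r * r := by field_simp
  constructor
  · rw [hzr, abs_mul, abs_of_pos h0]
    nlinarith [abs_nonneg r]
  · rw [hzr, show z t / r * r - r = (z t / r - 1) * r by ring, abs_mul, abs_of_nonpos (by linarith)]
    nlinarith [abs_nonneg r]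

/-! ### Inversion of the Abel integral -/

/-- The Beta integral `B(α, 1-α)` on an arbitrary interval. -/
theorem integral_rpow_mul_rpow {α : ℝ} (hα : α ∈ Ioo (0 : ℝ) 1) {r t : ℝ} (hrt : r < t) :
    ∫ s in r..t, (t - s) ^ (α - 1) * (s - r) ^ (-α)
      = Real.Gamma α * Real.Gamma (1 - α) := by
  have h01 : ∫ x in (0 : ℝ)..1, x ^ (-α) * (1 - x) ^ (α - 1)
      = Real.Gamma α * Real.Gamma (1 - α) := by
    have h1 := ProbabilityTheory.beta_eq_betaIntegralReal (1 - α) α (by linarith [hα.2]) hα.1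
    rw [ProbabilityTheory.beta, sub_add_cancel, Real.Gamma_one, div_one] at h1
    rw [mul_comm, h1, Complex.betaIntegral]
    have h2 : ∫ x in (0 : ℝ)..1, (x : ℂ) ^ (((1 - α : ℝ) : ℂ) - 1) * (1 - (x : ℂ)) ^ ((α : ℂ) - 1)
        = ∫ x in (0 : ℝ)..1, ((x ^ (-α) * (1 - x) ^ (α - 1) : ℝ) : ℂ) := by
      refine intervalIntegral.integral_congr fun x hx => ?_
      rw [uIcc_of_le zero_le_one] at hx
      rw [Complex.ofReal_mul, Complex.ofReal_cpow hx.1, Complex.ofReal_cpow (by linarith [hx.2])]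
      push_cast
      congr 2
      ring
    rw [h2, intervalIntegral.integral_ofReal, Complex.ofReal_re]
  have hd : 0 < t - r := by linarith
  have h3 := intervalIntegral.integral_comp_mul_add
    (fun s => (t - s) ^ (α - 1) * (s - r) ^ (-α)) (a := 0) (b := 1) hd.ne' r
  rw [mul_zero, zero_add, mul_one, sub_add_cancel] at h3
  rw [← h01]
  have h4 : ∫ x in (0 : ℝ)..1, (t - ((t - r) * x + r)) ^ (α - 1) * ((t - r) * x + r - r) ^ (-α)
      = ∫ x in (0 : ℝ)..1, (t - r)⁻¹ * (x ^ (-α) * (1 - x) ^ (α - 1)) := by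
    refine intervalIntegral.integral_congr fun x hx => ?_
    rw [uIcc_of_le zero_le_one] at hx
    rw [show t - ((t - r) * x + r) = (t - r) * (1 - x) by ring, add_sub_cancel_right,
      Real.mul_rpow hd.le (by linarith [hx.2]), Real.mul_rpow hd.le hx.1]
    have : (t - r) ^ (α - 1) * (t - r) ^ (-α) = (t - r)⁻¹ := by
      rw [← Real.rpow_add hd, show α - 1 + -α = -1 by ring, Real.rpow_neg_one]
    calc _ = ((t - r) ^ (α - 1) * (t - r) ^ (-α)) * (x ^ (-α) * (1 - x) ^ (α - 1)) := by ring
      _ = _ := by rw [this]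
  rw [h4, intervalIntegral.integral_const_mul, smul_eq_mul] at h3
  have := inv_ne_zero hd.ne'
  exact (mul_left_cancel₀ this h3).symm

theorem hasDerivWithinAt_primitive {a b c x : ℝ} {g : ℝ → ℝ} (hg : ContinuousOn g (Icc a b))
    (hc : c ∈ Icc a b) (hx : x ∈ Icc a b) :
    HasDerivWithinAt (fun t => ∫ s in c..t, g s) (g x) (Icc a b) x := by
  have : Fact (x ∈ Icc a b) := ⟨hx⟩
  exact intervalIntegral.integral_hasDerivWithinAt_right
    ((hg.mono (uIcc_subset_Icc hc hx)).intervalIntegrable)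
    (hg.stronglyMeasurableAtFilter_nhdsWithin measurableSet_Icc x) (hg x hx)

/-- The semigroup property `I^α I^{1-α} = I¹` of the Riemann-Liouville integrals. -/
theorem integral_abel_abel {α : ℝ} (hα : α ∈ Ioo (0 : ℝ) 1) {y : ℝ → ℝ} (hy : Continuous y)
    {t : ℝ} (ht : 0 ≤ t) :
    ∫ s in (0 : ℝ)..t, (t - s) ^ (α - 1) * ∫ r in (0 : ℝ)..s, (s - r) ^ (-α) * y r
      = Real.Gamma α * Real.Gamma (1 - α) * ∫ r in (0 : ℝ)..t, y r := by
  set μ : Measure ℝ := volume.restrict (Ioc 0 t) with hμ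
  set H : ℝ × ℝ → ℝ := fun p =>
    {p : ℝ × ℝ | p.2 ≤ p.1}.indicator (fun p => (t - p.1) ^ (α - 1) * (p.1 - p.2) ^ (-α)) p with hH
  have hHm : Measurable H := by
    refine Measurable.indicator ?_ (measurableSet_le measurable_snd measurable_fst)
    fun_prop
  have hin : ∀ s ∈ Ioc 0 t, ∀ (f : ℝ → ℝ), ∫ r in Ioc 0 t, (Iic s).indicator f r
      = ∫ r in (0 : ℝ)..s, f r := by
    intro s hs f
    rw [setIntegral_indicator measurableSet_Iic, intervalIntegral.integral_of_le hs.1.le]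
    congr 2
    ext r; simp only [mem_Ioc, mem_inter_iff, mem_Iic]
    exact ⟨fun h => ⟨h.1.1, h.2⟩, fun h => ⟨⟨h.1, h.2.trans hs.2⟩, h.2⟩⟩
  have hHs : ∀ s r, H (s, r) = (Iic s).indicator (fun r => (t - s) ^ (α - 1) * (s - r) ^ (-α)) r := by
    intro s r
    by_cases h : r ≤ s <;> simp [hH, indicator, h]
  have hHr : ∀ s r, H (s, r) = (Ici r).indicator (fun s => (t - s) ^ (α - 1) * (s - r) ^ (-α)) s := by
    intro s r
    by_cases h : r ≤ s <;> simp [hH, indicator, h]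
  have hnα : -1 < -α := by linarith [hα.2]
  have hHint : Integrable H (μ.prod μ) := by
    -- the iterated integral of `H` over `r` is `(t-s)^{α-1} s^{1-α} / (1-α)`
    rw [integrable_prod_iff hHm.aestronglyMeasurable]
    constructor
    · refine (ae_restrict_mem measurableSet_Ioc).mono fun s hs => ?_
      simp_rw [hHs]
      rw [integrable_indicator_iff measurableSet_Iic, IntegrableOn, hμ,
        Measure.restrict_restrict measurableSet_Iic]
      have h1 : Iic s ∩ Ioc 0 t = Ioc 0 s := by
        ext r; simp only [mem_Ioc, mem_inter_iff, mem_Iic]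
        exact ⟨fun h => ⟨h.2.1, h.1⟩, fun h => ⟨h.2, h.1, h.2.trans hs.2⟩⟩
      rw [h1]
      exact (intervalIntegrable_iff_integrableOn_Ioc_of_le hs.1.le).1
        ((intervalIntegrable_sub_rpow hnα s 0 s).const_mul _)
    · have h2 : Integrable (fun s => (t - s) ^ (α - 1) * (s ^ (-α + 1) / (-α + 1))) μ := by
        refine (intervalIntegrable_iff_integrableOn_Ioc_of_le ht).1
          (intervalIntegrable_sub_rpow_mul (by linarith [hα.1]) t ?_)
        have := Real.continuous_rpow_const (by linarith : 0 ≤ -α + 1)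
        exact (this.div_const _).continuousOn
      refine h2.congr ((ae_restrict_mem measurableSet_Ioc).mono fun s hs => ?_)
      have h3 : ∀ r, ‖H (s, r)‖
          = (Iic s).indicator (fun r => (t - s) ^ (α - 1) * (s - r) ^ (-α)) r := by
        intro r
        rw [hHs, Real.norm_of_nonneg]
        refine indicator_nonneg (fun r hr => ?_) r
        have hr' : r ≤ s := hr
        exact mul_nonneg (Real.rpow_nonneg (by linarith [hs.2]) _)
          (Real.rpow_nonneg (by linarith) _)
      simp_rw [h3]
      rw [hin s hs, intervalIntegral.integral_const_mul, integral_sub_rpow hnα, sub_zero]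
  have hFint : Integrable (fun p : ℝ × ℝ => H p * y p.2) (μ.prod μ) := by
    obtain ⟨M, hM⟩ := isCompact_Icc.exists_bound_of_continuousOn (hy.continuousOn (s := Icc 0 t))
    refine hHint.mul_bdd (c := M) (hy.comp continuous_snd).aestronglyMeasurable ?_
    have : ∀ᵐ r ∂μ, ‖y r‖ ≤ M :=
      (ae_restrict_mem measurableSet_Ioc).mono fun r hr => hM r ⟨hr.1.le, hr.2⟩
    exact Measure.quasiMeasurePreserving_snd.ae this
  have e1 : ∫ s in (0 : ℝ)..t, (t - s) ^ (α - 1) * ∫ r in (0 : ℝ)..s, (s - r) ^ (-α) * y r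
      = ∫ s, ∫ r, H (s, r) * y r ∂μ ∂μ := by
    rw [intervalIntegral.integral_of_le ht]
    refine setIntegral_congr_fun measurableSet_Ioc fun s hs => ?_
    show _ = ∫ r in Ioc 0 t, H (s, r) * y r
    rw [← intervalIntegral.integral_const_mul, ← hin s hs]
    congr 1; ext r
    rw [hHs]
    by_cases h : r ≤ s <;> simp [indicator, h, mul_assoc]
  rw [e1, integral_integral_swap hFint, intervalIntegral.integral_of_le ht,
    ← integral_const_mul, integral_Ioc_eq_integral_Ioo, hμ, integral_Ioc_eq_integral_Ioo]
  refine setIntegral_congr_fun measurableSet_Ioo fun r hr => ?_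
  show ∫ s in Ioc 0 t, H (s, r) * y r = _
  rw [integral_mul_const]
  congr 1
  simp_rw [hHr]
  rw [setIntegral_indicator measurableSet_Ici]
  have : Ioc 0 t ∩ Ici r = Icc r t := by
    ext x; simp only [mem_Ioc, mem_inter_iff, mem_Ici, mem_Icc]
    exact ⟨fun h => ⟨h.2, h.1.2⟩, fun h => ⟨⟨hr.1.trans_le h.1, h.2⟩, h.1⟩⟩
  rw [this, integral_Icc_eq_integral_Ioc, ← intervalIntegral.integral_of_le hr.2.le,
    integral_rpow_mul_rpow hα hr.2]

theorem continuousOn_abel {α : ℝ} (hα : 0 < α) {z : ℝ → ℝ} (hz : Continuous z) {T : ℝ} :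
    ContinuousOn (fun t => ∫ s in (0 : ℝ)..t, (t - s) ^ (α - 1) * z s) (Icc 0 T) := by
  have h1 : ∀ t ∈ Icc 0 T, ∫ s in (0 : ℝ)..t, (t - s) ^ (α - 1) * z s
      = t ^ α * ∫ x in (0 : ℝ)..1, x ^ (α - 1) * z (t - t * x) := by
    intro t ht
    rcases ht.1.eq_or_lt with h | h
    · rw [← h]; simp [Real.zero_rpow hα.ne']
    have h2 := intervalIntegral.integral_comp_sub_mul
      (fun s => (t - s) ^ (α - 1) * z s) (a := 0) (b := 1) h.ne' t
    rw [mul_one, sub_self, mul_zero, sub_zero, smul_eq_mul, inv_mul_eq_div,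
      eq_div_iff h.ne'] at h2
    rw [← h2, mul_comm, ← intervalIntegral.integral_const_mul, ← intervalIntegral.integral_const_mul]
    refine intervalIntegral.integral_congr fun x hx => ?_
    rw [uIcc_of_le zero_le_one] at hx
    rw [sub_sub_cancel, Real.mul_rpow h.le hx.1]
    have : t * t ^ (α - 1) = t ^ α := by
      rw [← Real.rpow_one_add' h.le (by linarith)]; congr 1; ring
    rw [← this]; ring
  refine ContinuousOn.congr ?_ h1
  refine (Real.continuous_rpow_const hα.le).continuousOn.mul ?_
  obtain ⟨M, hM⟩ := isCompact_Icc.exists_bound_of_continuousOn (hz.continuousOn (s := Icc 0 T))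
  intro t₀ ht₀
  refine intervalIntegral.continuousWithinAt_of_dominated_interval
    (bound := fun x => x ^ (α - 1) * M) ?_ ?_ ?_ ?_
  · refine Eventually.of_forall fun t => ?_
    refine AEStronglyMeasurable.mul ?_ (by fun_prop)
    exact (measurable_id.pow_const _).aestronglyMeasurable
  · refine eventually_mem_nhdsWithin.mono fun t ht => Eventually.of_forall fun x hx => ?_
    rw [uIoc_of_le zero_le_one] at hx
    rw [norm_mul, Real.norm_of_nonneg (Real.rpow_nonneg hx.1.le _)]
    refine mul_le_mul_of_nonneg_left (hM _ ⟨?_, ?_⟩) (Real.rpow_nonneg hx.1.le _)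
    · nlinarith [ht.1, hx.2]
    · nlinarith [ht.1, hx.1, ht.2]
  · exact (intervalIntegral.intervalIntegrable_rpow' (by linarith)).mul_const M
  · exact Eventually.of_forall fun x _ => (by fun_prop : Continuous fun t =>
      x ^ (α - 1) * z (t - t * x)).continuousWithinAt

/-- If `I^{1-α} y = I¹ z` then `y = I^α z`: apply `I^α`, which commutes with `I¹`, and
differentiate. -/
theorem abel_inversion {α T : ℝ} (hα : α ∈ Ioo (0 : ℝ) 1) (hT₀ : 0 < T) {y z : ℝ → ℝ}
    (hy : ContinuousOn y (Icc 0 T)) (hz : ContinuousOn z (Icc 0 T))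
    (heq : ∀ t ∈ Icc 0 T, (Real.Gamma (1 - α))⁻¹ * ∫ s in (0 : ℝ)..t, (t - s) ^ (-α) * y s
      = ∫ s in (0 : ℝ)..t, z s) :
    ∀ t ∈ Icc 0 T, y t = (Real.Gamma α)⁻¹ * ∫ s in (0 : ℝ)..t, (t - s) ^ (α - 1) * z s := by
  intro t₁ ht₁
  have hT : 0 ≤ T := ht₁.1.trans ht₁.2
  -- continuous extensions to the whole line
  wlog hcont : Continuous y ∧ Continuous z generalizing y z
  · have hY := hy.domRestrict.Icc_extend' (h := hT)
    have hZ := hz.domRestrict.Icc_extend' (h := hT)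
    have eY : ∀ s ∈ Icc 0 T, IccExtend hT ((Icc 0 T).domRestrict y) s = y s := fun s hs => by
      rw [IccExtend_of_mem _ _ hs]; rfl
    have eZ : ∀ s ∈ Icc 0 T, IccExtend hT ((Icc 0 T).domRestrict z) s = z s := fun s hs => by
      rw [IccExtend_of_mem _ _ hs]; rfl
    have hsub : ∀ t ∈ Icc 0 T, ∀ s ∈ uIcc 0 t, s ∈ Icc 0 T := fun t ht s hs => by
      rw [uIcc_of_le ht.1] at hs
      exact ⟨hs.1, hs.2.trans ht.2⟩
    have key := this (y := IccExtend hT ((Icc 0 T).domRestrict y))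
      (z := IccExtend hT ((Icc 0 T).domRestrict z)) hY.continuousOn hZ.continuousOn ?_ ⟨hY, hZ⟩
    · rw [← eY t₁ ht₁, key]
      congr 1
      exact intervalIntegral.integral_congr fun s hs => by simp only [eZ s (hsub t₁ ht₁ s hs)]
    · intro t ht
      rw [intervalIntegral.integral_congr (g := fun s => (t - s) ^ (-α) * y s)
        (fun s hs => by simp only [eY s (hsub t ht s hs)]),
        intervalIntegral.integral_congr (g := z) (fun s hs => eZ s (hsub t ht s hs))]
      exact heq t ht
  obtain ⟨hy', hz'⟩ := hcont
  have hΓ : Real.Gamma α ≠ 0 := (Real.Gamma_pos_of_pos hα.1).ne'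
  have hΓ' : Real.Gamma (1 - α) ≠ 0 := (Real.Gamma_pos_of_pos (by linarith [hα.2])).ne'
  -- `I^α I¹ z = I¹ I^α z`, the formula for the Caputo derivative of order `1 - α` of `I¹ z`
  have hI := (HasCaputoDeriv.of_deriv (α := 1 - α) (T := T) (by linarith [hα.1])
    (u := fun t => ∫ s in (0 : ℝ)..t, z s) (u' := z) (hz'.integrableOn_Ioc)
    (fun t _ => by simp)).2
  simp only [smul_eq_mul, intervalIntegral.integral_same, sub_zero, sub_sub_cancel, neg_sub] at hI
  have hprim : ∀ t ∈ Icc 0 T, ∫ s in (0 : ℝ)..t, y s = ∫ s in (0 : ℝ)..t,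
      (Real.Gamma α)⁻¹ * ∫ r in (0 : ℝ)..s, (s - r) ^ (α - 1) * z r := by
    intro t ht
    rw [← hI t ht]
    have h1 : ∫ s in (0 : ℝ)..t, (t - s) ^ (α - 1) * ∫ r in (0 : ℝ)..s, z r
        = (Real.Gamma (1 - α))⁻¹ * ∫ s in (0 : ℝ)..t,
          (t - s) ^ (α - 1) * ∫ r in (0 : ℝ)..s, (s - r) ^ (-α) * y r := by
      rw [← intervalIntegral.integral_const_mul]
      refine intervalIntegral.integral_congr fun s hs => ?_
      rw [uIcc_of_le ht.1] at hs
      rw [← heq s ⟨hs.1, hs.2.trans ht.2⟩]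
      ring
    rw [h1, integral_abel_abel hα hy' ht.1]
    field_simp
  have hcy : ContinuousOn (fun s => (Real.Gamma α)⁻¹ * ∫ r in (0 : ℝ)..s, (s - r) ^ (α - 1) * z r)
      (Icc 0 T) := (continuousOn_abel hα.1 hz').const_mul _
  -- differentiate the identity of the primitives
  have h1 := hasDerivWithinAt_primitive hy ⟨le_rfl, hT⟩ ht₁
  have h2 := (hasDerivWithinAt_primitive hcy ⟨le_rfl, hT⟩ ht₁).congr_of_mem hprim ht₁
  exact (uniqueDiffOn_Icc hT₀ t₁ ht₁).eq_deriv _ h1 h2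

/-- The deviation of a solution of `∂ₜ^α y + lam y = r`, `y(0) = 0`, from its leading term
`r t^α / Γ(1+α)`. With `X = lam t^α / Γ(1+α)` the relative deviation is at most `1` and at most `X`,
hence at most `X ^ θ`. -/
theorem mode_estimate {α T : ℝ} (hα : α ∈ Ioo (0 : ℝ) 1) (hT : 0 < T) {lam r : ℝ} (hlam : 0 ≤ lam)
    {y : ℝ → ℝ} (hy : ContinuousOn y (Icc 0 T))
    (heq : ∀ t ∈ Icc 0 T, (Real.Gamma (1 - α))⁻¹ * ∫ s in (0 : ℝ)..t, (t - s) ^ (-α) * y s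
      = ∫ s in (0 : ℝ)..t, (r - lam * y s))
    {θ : ℝ} (hθ : θ ∈ Icc (0 : ℝ) 1) {t : ℝ} (ht : t ∈ Icc 0 T) :
    |y t - r * (t ^ α / Real.Gamma (1 + α))|
      ≤ |r| * (t ^ α / Real.Gamma (1 + α)) * (lam * (t ^ α / Real.Gamma (1 + α))) ^ θ := by
  have hz : ContinuousOn (fun s => r - lam * y s) (Icc 0 T) :=
    continuousOn_const.sub (hy.const_mul lam)
  have hinv := abel_inversion hα hT hy hz heq
  have hΓ := Real.Gamma_pos_of_pos hα.1
  have hG : Real.Gamma (1 + α) = α * Real.Gamma α := by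
    rw [add_comm, Real.Gamma_add_one hα.1.ne']
  have hα0 := hα.1
  have hb := volterra_bounds hα (c := lam * (Real.Gamma α)⁻¹) (r := r) (by positivity) hz
    (fun t ht => by
      show r - lam * y t = _
      conv_lhs => rw [hinv t ht]
      ring)
  have habel : ∀ t ∈ Icc 0 T, ∀ (v : ℝ → ℝ), ContinuousOn v (Icc 0 T) → ∀ M,
      (∀ s ∈ Icc 0 t, |v s| ≤ M) →
      |(Real.Gamma α)⁻¹ * ∫ s in (0 : ℝ)..t, (t - s) ^ (α - 1) * v s|
        ≤ M * (t ^ α / Real.Gamma (1 + α)) := by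
    intro t ht v hv M hM
    have h1 := abs_integral_sub_rpow_mul_le hα.1 ht.1 (hv.mono (Icc_subset_Icc_right ht.2)) hM
    rw [sub_zero] at h1
    rw [abs_mul, abs_of_pos (inv_pos.2 hΓ), hG]
    calc _ ≤ (Real.Gamma α)⁻¹ * (M * (t ^ α / α)) :=
          mul_le_mul_of_nonneg_left h1 (inv_pos.2 hΓ).le
      _ = _ := by field_simp
  have hybd : ∀ t ∈ Icc 0 T, |y t| ≤ |r| * (t ^ α / Real.Gamma (1 + α)) := by
    intro t ht
    rw [hinv t ht]
    exact habel t ht _ hz _ fun s hs => (hb s ⟨hs.1, hs.2.trans ht.2⟩).1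
  have hdev : y t - r * (t ^ α / Real.Gamma (1 + α))
      = (Real.Gamma α)⁻¹ * ∫ s in (0 : ℝ)..t, (t - s) ^ (α - 1) * (r - lam * y s - r) := by
    have hc : ∀ {v : ℝ → ℝ}, ContinuousOn v (Icc 0 T) →
        IntervalIntegrable (fun s => (t - s) ^ (α - 1) * v s) volume 0 t := fun hv =>
      intervalIntegrable_sub_rpow_mul (by linarith) t
        (by rw [uIcc_of_le ht.1]; exact hv.mono (Icc_subset_Icc_right ht.2))
    simp_rw [mul_sub ((t - _) ^ (α - 1)) _ r]
    rw [intervalIntegral.integral_sub (hc hz) (hc continuousOn_const), mul_sub, ← hinv t ht,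
      intervalIntegral.integral_mul_const, integral_sub_rpow (by linarith), hG, sub_add_cancel,
      sub_zero]
    field_simp
  have hv : ContinuousOn (fun s => r - lam * y s - r) (Icc 0 T) := hz.sub continuousOn_const
  set A := t ^ α / Real.Gamma (1 + α) with hA
  have hA0 : 0 ≤ A := div_nonneg (Real.rpow_nonneg ht.1 _) (by rw [hG]; positivity)
  have hB1 : |y t - r * A| ≤ |r| * A := by
    rw [hdev]
    exact habel t ht _ hv _ fun s hs => (hb s ⟨hs.1, hs.2.trans ht.2⟩).2
  have hB2 : |y t - r * A| ≤ |r| * A * (lam * A) := by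
    rw [hdev, show |r| * A * (lam * A) = lam * (|r| * A) * A by ring]
    refine habel t ht _ hv _ fun s hs => ?_
    rw [sub_sub_cancel_left, abs_neg, abs_mul, abs_of_nonneg hlam]
    refine mul_le_mul_of_nonneg_left ((hybd s ⟨hs.1, hs.2.trans ht.2⟩).trans ?_) hlam
    refine mul_le_mul_of_nonneg_left ?_ (abs_nonneg r)
    refine div_le_div_of_nonneg_right (Real.rpow_le_rpow hs.1 hs.2 hα.1.le) ?_
    rw [hG]; positivity
  rcases le_total 1 (lam * A) with h | h
  · exact hB1.trans (le_mul_of_one_le_right (by positivity) (Real.one_le_rpow h hθ.1))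
  · refine hB2.trans (mul_le_mul_of_nonneg_left ?_ (by positivity))
    rcases (mul_nonneg hlam hA0).eq_or_lt with h0 | h0
    · rw [← h0]; exact Real.rpow_nonneg le_rfl _
    · have := Real.rpow_le_rpow_of_exponent_ge h0 h hθ.2
      rwa [Real.rpow_one] at this

/-! ### Orthogonal decompositions of a Hilbert space -/

section OrthogonalDecomposition

theorem hasSum_norm_sq_of_hasSum {E ι : Type*} [NormedAddCommGroup E] [InnerProductSpace ℝ E]
    {F : ι → Submodule ℝ E}
    (hF : OrthogonalFamily ℝ (fun i => F i) fun i => (F i).subtypeₗᵢ)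
    {x : ι → E} (hx : ∀ i, x i ∈ F i) {v : E} (hv : HasSum x v) :
    HasSum (fun i => ‖x i‖ ^ 2) (‖v‖ ^ 2) := by
  have h : ∀ s : Finset ι, ∑ i ∈ s, ‖x i‖ ^ 2 = ‖∑ i ∈ s, x i‖ ^ 2 := fun s =>
    (hF.norm_sum (fun i => ⟨x i, hx i⟩) s).symm
  unfold HasSum
  simp_rw [h]
  exact hv.norm.pow 2

variable {E ι : Type*} [NormedAddCommGroup E] [InnerProductSpace ℝ E]
  {F : ι → Submodule ℝ E} [∀ i, (F i).HasOrthogonalProjection]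

theorem starProjection_eq_of_hasSum
    (hF : OrthogonalFamily ℝ (fun i => F i) fun i => (F i).subtypeₗᵢ)
    {x : ι → E} (hx : ∀ i, x i ∈ F i) {v : E} (hv : HasSum x v) (i : ι) :
    (F i).starProjection v = x i := by
  classical
  have h1 : HasSum (fun j => (F i).starProjection (x j)) ((F i).starProjection v) :=
    hv.mapL (F i).starProjection
  have h2 : ∀ j, j ≠ i → (F i).starProjection (x j) = 0 := by
    intro j hj
    rw [Submodule.starProjection_apply_eq_zero_iff]
    exact (hF.isOrtho hj).le (hx j)
  have h3 := h1.unique (hasSum_single i h2)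
  rw [h3]
  exact Submodule.starProjection_eq_self_iff.2 (hx i)

theorem hasSum_starProjection [CompleteSpace E] [∀ i, CompleteSpace (F i)]
    (hF : OrthogonalFamily ℝ (fun i => F i) fun i => (F i).subtypeₗᵢ)
    (htot : (⨆ i, F i)ᗮ = ⊥) (v : E) : HasSum (fun i => (F i).starProjection v) v := by
  have hS : IsHilbertSum ℝ (fun i => F i) fun i => (F i).subtypeₗᵢ :=
    IsHilbertSum.mkInternal F hF (Submodule.topologicalClosure_eq_top_iff.2 htot).ge
  have h1 := hS.hasSum_linearIsometryEquiv_symm (hS.linearIsometryEquiv v)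
  rw [LinearIsometryEquiv.symm_apply_apply] at h1
  have h2 := starProjection_eq_of_hasSum hF (fun i => (hS.linearIsometryEquiv v i).2) h1
  simp_rw [h2]
  exact h1

/-- For square-summable coefficients, the multiplier series `∑ᵢ cᵢ Pᵢ v` converges. -/
theorem exists_hasSum_multiplier [CompleteSpace E]
    (hF : OrthogonalFamily ℝ (fun i => F i) fun i => (F i).subtypeₗᵢ)
    (c : ι → ℝ) (v : E) (hc : Summable fun i => c i ^ 2 * ‖(F i).starProjection v‖ ^ 2) :
    ∃ w, HasSum (fun i => c i • (F i).starProjection v) w ∧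
      (∀ i, (F i).starProjection w = c i • (F i).starProjection v) ∧
      ‖w‖ ^ 2 = ∑' i, c i ^ 2 * ‖(F i).starProjection v‖ ^ 2 := by
  have hmem : ∀ i, c i • (F i).starProjection v ∈ F i := fun i =>
    (F i).smul_mem _ ((F i).starProjection_apply_mem v)
  have hn : ∀ i, ‖c i • (F i).starProjection v‖ ^ 2 = c i ^ 2 * ‖(F i).starProjection v‖ ^ 2 :=
    fun i => by rw [norm_smul, mul_pow, Real.norm_eq_abs, sq_abs]
  have h1 := (hF.summable_iff_norm_sq_summable
    (fun i => (⟨c i • (F i).starProjection v, hmem i⟩ : F i))).2 (by simpa [hn] using hc)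
  obtain ⟨w, hw⟩ := h1
  have hw' : HasSum (fun i => c i • (F i).starProjection v) w := hw
  refine ⟨w, hw', starProjection_eq_of_hasSum hF hmem hw', ?_⟩
  have h2 := (hasSum_norm_sq_of_hasSum hF hmem hw').tsum_eq
  rw [← h2]
  exact tsum_congr hn

end OrthogonalDecomposition

/-! ### Primitives of square-integrable functions -/

/-- The Lebesgue measure on `Ω = (0,1)`. -/
noncomputable abbrev volΩ : Measure ℝ := (volume : Measure ℝ).restrict (Ioo (0 : ℝ) 1)

instance : IsProbabilityMeasure volΩ := ⟨by simp [volΩ]⟩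

theorem memLp_of_continuousOn {V : ℝ → ℝ} (hV : ContinuousOn V (Icc 0 1)) (r : ENNReal) :
    MemLp V r volΩ := by
  obtain ⟨M, hM⟩ := isCompact_Icc.exists_bound_of_continuousOn hV
  refine MemLp.of_bound ((hV.mono Ioo_subset_Icc_self).aestronglyMeasurable measurableSet_Ioo) M ?_
  exact (ae_restrict_mem measurableSet_Ioo).mono fun x hx => hM x (Ioo_subset_Icc_self hx)

theorem intervalIntegrable_of_integrable {p : ℝ → ℝ} (hp : Integrable p volΩ) {a b : ℝ}
    (ha : a ∈ Icc (0 : ℝ) 1) (hb : b ∈ Icc (0 : ℝ) 1) : IntervalIntegrable p volume a b := by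
  have h : IntervalIntegrable p volume 0 1 := by
    rw [intervalIntegrable_iff_integrableOn_Ioo_of_le zero_le_one]
    exact hp
  refine h.mono_set ?_
  rw [uIcc_of_le (zero_le_one' ℝ)]
  exact uIcc_subset_Icc ha hb

theorem L2.integrable (p : L2) : Integrable p volΩ := (Lp.memLp p).integrable one_le_two

theorem L2.intervalIntegrable (p : L2) {a b : ℝ} (ha : a ∈ Icc (0 : ℝ) 1)
    (hb : b ∈ Icc (0 : ℝ) 1) : IntervalIntegrable p volume a b :=
  intervalIntegrable_of_integrable p.integrable ha hb

theorem integral_volΩ (p : ℝ → ℝ) : ∫ x, p x ∂volΩ = ∫ x in (0 : ℝ)..1, p x := by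
  rw [intervalIntegral.integral_of_le zero_le_one, integral_Ioc_eq_integral_Ioo]

theorem inner_eq_integral (v w : L2) : inner ℝ v w = ∫ x in (0 : ℝ)..1, v x * w x := by
  rw [← integral_volΩ, MeasureTheory.L2.inner_def]
  congr 1; ext x
  simp [mul_comm]

theorem integral_congr_volΩ {p q : ℝ → ℝ} (h : p =ᵐ[volΩ] q) {a b : ℝ} (ha : a ∈ Icc (0 : ℝ) 1)
    (hb : b ∈ Icc (0 : ℝ) 1) : ∫ x in a..b, p x = ∫ x in a..b, q x := by
  have h1 : ∀ᵐ x ∂(volume : Measure ℝ), x ∈ Ioo (0 : ℝ) 1 → p x = q x :=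
    (ae_restrict_iff' measurableSet_Ioo).1 h
  have h2 : ∀ᵐ x ∂(volume : Measure ℝ), x ≠ 1 := by simp [ae_iff]
  refine intervalIntegral.integral_congr_ae ?_
  filter_upwards [h1, h2] with x hx hx1 hxab
  have h3 := uIoc_subset_uIcc hxab
  have h4 := uIcc_subset_Icc ha hb h3
  refine hx ⟨?_, lt_of_le_of_ne h4.2 hx1⟩
  rw [mem_uIoc] at hxab
  rcases hxab with h | h
  · exact ha.1.trans_lt h.1
  · exact hb.1.trans_lt h.1

/-- The indicator function of `(x,y)` as an element of `L²(Ω)`. -/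
noncomputable def ind (x y : ℝ) : L2 :=
  indicatorConstLp 2 (measurableSet_Ioo : MeasurableSet (Ioo x y)) (measure_ne_top volΩ _) 1

theorem inner_ind {x y : ℝ} (hx : 0 ≤ x) (hxy : x ≤ y) (hy : y ≤ 1) (p : L2) :
    inner ℝ (ind x y) p = ∫ t in x..y, p t := by
  rw [ind, MeasureTheory.L2.inner_indicatorConstLp_one, intervalIntegral.integral_of_le hxy,
    integral_Ioc_eq_integral_Ioo, Measure.restrict_restrict measurableSet_Ioo,
    inter_eq_left.2 (Ioo_subset_Ioo hx hy)]

theorem norm_ind_le {x y : ℝ} (hxy : x ≤ y) : ‖ind x y‖ ≤ √(y - x) := by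
  rw [ind, norm_indicatorConstLp two_ne_zero ENNReal.ofNat_ne_top, norm_one, one_mul,
    ENNReal.toReal_ofNat, ← Real.sqrt_eq_rpow]
  refine Real.sqrt_le_sqrt ?_
  have h1 : volΩ.real (Ioo x y) ≤ volume.real (Ioo x y) :=
    ENNReal.toReal_mono (by simp) (Measure.restrict_apply_le _ _)
  simpa [Real.volume_real_Ioo_of_le hxy] using h1

theorem abs_integral_le_sqrt {x y : ℝ} (hx : 0 ≤ x) (hxy : x ≤ y) (hy : y ≤ 1) (p : L2) :
    |∫ t in x..y, p t| ≤ √(y - x) * ‖p‖ := by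
  rw [← inner_ind hx hxy hy]
  exact (abs_real_inner_le_norm _ _).trans
    (mul_le_mul_of_nonneg_right (norm_ind_le hxy) (norm_nonneg _))

/-- The primitive of `p` that vanishes at `1`. -/
noncomputable def prim (p : ℝ → ℝ) (x : ℝ) : ℝ := ∫ y in (1 : ℝ)..x, p y

theorem prim_one (p : ℝ → ℝ) : prim p 1 = 0 := intervalIntegral.integral_same

theorem zero_mem_Icc01 : (0 : ℝ) ∈ Icc (0 : ℝ) 1 := ⟨le_rfl, zero_le_one⟩
theorem one_mem_Icc01 : (1 : ℝ) ∈ Icc (0 : ℝ) 1 := ⟨zero_le_one, le_rfl⟩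

theorem absolutelyContinuous_prim (p : L2) {x c : ℝ} (hx : x ∈ Icc (0 : ℝ) 1)
    (hc : c ∈ Icc x 1) :
    AbsolutelyContinuousOnInterval (fun t => ∫ y in c..t, p y) x 1 :=
  (p.intervalIntegrable hx one_mem_Icc01).absolutelyContinuousOnInterval_intervalIntegral
    (by rwa [uIcc_of_le hx.2])

theorem continuousOn_primitive (p : L2) {c : ℝ} (hc : c ∈ Icc (0 : ℝ) 1) :
    ContinuousOn (fun t => ∫ y in c..t, p y) (Icc 0 1) := by
  have := (absolutelyContinuous_prim p zero_mem_Icc01 hc).continuousOn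
  rwa [uIcc_of_le zero_le_one] at this

theorem continuousOn_prim (p : L2) : ContinuousOn (prim p) (Icc 0 1) :=
  continuousOn_primitive p one_mem_Icc01

theorem prim_sub_prim (p : L2) {x y : ℝ} (hx : x ∈ Icc (0 : ℝ) 1) (hy : y ∈ Icc (0 : ℝ) 1) :
    prim p y - prim p x = ∫ t in x..y, p t := by
  rw [prim, prim, intervalIntegral.integral_interval_sub_left
    (p.intervalIntegrable one_mem_Icc01 hy) (p.intervalIntegrable one_mem_Icc01 hx)]

theorem abs_prim_sub_prim_le (p : L2) {x y : ℝ} (hx : 0 ≤ x) (hxy : x ≤ y) (hy : y ≤ 1) :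
    |prim p y - prim p x| ≤ √(y - x) * ‖p‖ := by
  rw [prim_sub_prim p ⟨hx, hxy.trans hy⟩ ⟨hx.trans hxy, hy⟩]
  exact abs_integral_le_sqrt hx hxy hy p

theorem abs_prim_le (p : L2) {x : ℝ} (hx : x ∈ Icc (0 : ℝ) 1) : |prim p x| ≤ ‖p‖ := by
  have h := abs_prim_sub_prim_le p hx.1 hx.2 le_rfl
  rw [prim_one, zero_sub, abs_neg] at h
  refine h.trans (mul_le_of_le_one_left (norm_nonneg _) ?_)
  rw [Real.sqrt_le_one]
  linarith [hx.1]

theorem ae_volΩ_of_forall {P : ℝ → Prop} (h : ∀ x ∈ Icc (0 : ℝ) 1, P x) : ∀ᵐ x ∂volΩ, P x :=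
  (ae_restrict_mem measurableSet_Ioo).mono fun x hx => h x (Ioo_subset_Icc_self hx)

theorem norm_L2_le_of_ae {v : L2} {C : ℝ} (hC : 0 ≤ C) (h : ∀ᵐ x ∂volΩ, |v x| ≤ C) :
    ‖v‖ ≤ C := by
  have h1 := Lp.norm_le_of_ae_bound (μ := volΩ) (p := 2) (f := v) hC h
  simpa [measureUnivNNReal] using h1

/-- The Volterra operator `p ↦ prim p` on `L²(Ω)`. -/
noncomputable def volterraJ : L2 →L[ℝ] L2 :=
  LinearMap.mkContinuous
    { toFun := fun p => (memLp_of_continuousOn (continuousOn_prim p) 2).toLp (prim p)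
      map_add' := fun p₁ p₂ => by
        rw [← MemLp.toLp_add]
        refine MemLp.toLp_congr _ _ (ae_volΩ_of_forall fun x hx => ?_)
        simp only [prim, Pi.add_apply]
        rw [integral_congr_volΩ (Lp.coeFn_add p₁ p₂) one_mem_Icc01 hx]
        exact intervalIntegral.integral_add (p₁.intervalIntegrable one_mem_Icc01 hx)
          (p₂.intervalIntegrable one_mem_Icc01 hx)
      map_smul' := fun c p => by
        rw [RingHom.id_apply, ← MemLp.toLp_const_smul]
        refine MemLp.toLp_congr _ _ (ae_volΩ_of_forall fun x hx => ?_)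
        simp only [prim, Pi.smul_apply]
        rw [integral_congr_volΩ (Lp.coeFn_smul c p) one_mem_Icc01 hx]
        exact intervalIntegral.integral_smul c _ }
    1 fun p => by
      rw [one_mul]
      refine norm_L2_le_of_ae (norm_nonneg _) ?_
      filter_upwards [(memLp_of_continuousOn (continuousOn_prim p) 2).coeFn_toLp,
        ae_volΩ_of_forall fun x hx => abs_prim_le p hx] with x h1 h2
      simp only [LinearMap.coe_mk, AddHom.coe_mk]
      rw [h1]
      exact h2

theorem represents_volterraJ (p : L2) : Represents (prim p) (volterraJ p) :=
  (memLp_of_continuousOn (continuousOn_prim p) 2).coeFn_toLp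

/-- Integration by parts on `[x,1]` for primitives of `p` and `w` with base points `c` and `d`. -/
theorem integral_deriv_parts (p w : L2) {x c d : ℝ} (hx : x ∈ Icc (0 : ℝ) 1) (hc : c ∈ Icc x 1)
    (hd : d ∈ Icc x 1) :
    ∫ t in x..1, (p t * (∫ y in d..t, w y) + (∫ y in c..t, p y) * w t)
      = (∫ y in c..1, p y) * (∫ y in d..1, w y) - (∫ y in c..x, p y) * (∫ y in d..x, w y) := by
  rw [← (absolutelyContinuous_prim p hx hc).integral_deriv_mul_eq_sub
    (absolutelyContinuous_prim w hx hd)]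
  refine intervalIntegral.integral_congr_ae ?_
  filter_upwards [(p.intervalIntegrable hx one_mem_Icc01).ae_hasDerivAt_integral,
    (w.intervalIntegrable hx one_mem_Icc01).ae_hasDerivAt_integral] with t h1 h2 ht
  have ht' := uIoc_subset_uIcc ht
  rw [(h1 ht' c (by rwa [uIcc_of_le hx.2])).deriv, (h2 ht' d (by rwa [uIcc_of_le hx.2])).deriv]

theorem inner_eq_integral_of_represents {v w : L2} {V W : ℝ → ℝ} (hv : Represents V v)
    (hw : Represents W w) : inner ℝ v w = ∫ x in (0 : ℝ)..1, V x * W x := by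
  rw [inner_eq_integral]
  refine integral_congr_volΩ ?_ zero_mem_Icc01 one_mem_Icc01
  filter_upwards [hv, hw] with x h1 h2
  rw [h1, h2]

theorem Represents.self (v : L2) : Represents v v := Eventually.of_forall fun _ => rfl

theorem Represents.eq {v w : L2} {V : ℝ → ℝ} (hv : Represents V v) (hw : Represents V w) :
    v = w :=
  Lp.ext (by filter_upwards [hv, hw] with x h1 h2; rw [h1, h2])

/-- The adjoint of the Volterra operator: minus the primitive that vanishes at `0`. -/
theorem represents_adjoint_volterraJ (w : L2) :
    Represents (fun x => -∫ y in (0 : ℝ)..x, w y) (ContinuousLinearMap.adjoint volterraJ w) := by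
  have hmem := memLp_of_continuousOn (continuousOn_primitive w zero_mem_Icc01).neg 2
  have hrep : Represents (fun x => -∫ y in (0 : ℝ)..x, w y) hmem.toLp := hmem.coeFn_toLp
  have : ContinuousLinearMap.adjoint volterraJ w = hmem.toLp := by
    refine ext_inner_left ℝ fun p => ?_
    rw [ContinuousLinearMap.adjoint_inner_right,
      inner_eq_integral_of_represents (represents_volterraJ p) (Represents.self w),
      inner_eq_integral_of_represents (Represents.self p) hrep]
    have h := integral_deriv_parts p w zero_mem_Icc01 one_mem_Icc01 zero_mem_Icc01
    rw [intervalIntegral.integral_same, intervalIntegral.integral_same, zero_mul, mul_zero,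
      sub_zero, intervalIntegral.integral_add] at h
    · simp only [mul_neg, intervalIntegral.integral_neg]
      simp only [prim]
      linarith
    · exact (p.intervalIntegrable zero_mem_Icc01 one_mem_Icc01).mul_continuousOn
        (by rw [uIcc_of_le zero_le_one]; exact continuousOn_primitive w zero_mem_Icc01)
    · exact (w.intervalIntegrable zero_mem_Icc01 one_mem_Icc01).continuousOn_mul
        (by rw [uIcc_of_le zero_le_one]; exact continuousOn_primitive p one_mem_Icc01)
  rw [this]
  exact hrep

/-- The Sobolev inequality `V(x)² ≤ 2 ‖V‖ ‖V'‖` for functions with `V(1) = 0`. -/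
theorem prim_sq_le (p : L2) {x : ℝ} (hx : x ∈ Icc (0 : ℝ) 1) :
    prim p x ^ 2 ≤ 2 * (‖volterraJ p‖ * ‖p‖) := by
  have h := integral_deriv_parts p p hx ⟨hx.2, le_rfl⟩ ⟨hx.2, le_rfl⟩
  rw [intervalIntegral.integral_same, zero_mul, zero_sub] at h
  have hii : ∀ a ∈ Icc (0 : ℝ) 1, IntervalIntegrable (fun t => prim p t * p t) volume a 1 :=
    fun a ha => (p.intervalIntegrable ha one_mem_Icc01).continuousOn_mul
      ((continuousOn_prim p).mono (uIcc_subset_Icc ha one_mem_Icc01))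
  have h1 : prim p x ^ 2 = -(2 * ∫ t in x..1, prim p t * p t) := by
    have h2 : ∫ t in x..1, (p t * (∫ y in (1 : ℝ)..t, p y) + (∫ y in (1 : ℝ)..t, p y) * p t)
        = 2 * ∫ t in x..1, prim p t * p t := by
      rw [← intervalIntegral.integral_const_mul]
      congr 1; ext t; simp only [prim]; ring
    rw [← h2, h, prim]; ring
  have h3 : |∫ t in x..1, prim p t * p t| ≤ ∫ t in (0 : ℝ)..1, |prim p t| * |p t| := by
    refine (intervalIntegral.abs_integral_le_integral_abs hx.2).trans ?_
    simp_rw [abs_mul]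
    have ha : ∀ a ∈ Icc (0 : ℝ) 1,
        IntervalIntegrable (fun t => |prim p t| * |p t|) volume a 1 := fun a ha => by
      simpa [abs_mul] using (hii a ha).abs
    refine intervalIntegral.integral_mono_interval hx.1 hx.2 le_rfl ?_ (ha 0 zero_mem_Icc01)
    exact Eventually.of_forall fun t => by positivity
  have h4 : ∫ t in (0 : ℝ)..1, |prim p t| * |p t| ≤ ‖volterraJ p‖ * ‖p‖ := by
    have e : inner ℝ |volterraJ p| |p| = ∫ t in (0 : ℝ)..1, |prim p t| * |p t| := by
      refine inner_eq_integral_of_represents ?_ (Lp.coeFn_abs p)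
      filter_upwards [Lp.coeFn_abs (volterraJ p), represents_volterraJ p] with t h5 h6
      rw [h5, h6]
    rw [← e, ← norm_abs_eq_norm (volterraJ p), ← norm_abs_eq_norm p]
    exact real_inner_le_norm _ _
  rw [h1]
  linarith [neg_abs_le (∫ t in x..1, prim p t * p t)]

theorem coeFn_L2_sum {ι : Type*} (s : Finset ι) (v : ι → L2) :
    ⇑(∑ i ∈ s, v i) =ᵐ[volΩ] fun x => ∑ i ∈ s, v i x := by
  classical
  induction s using Finset.induction_on with
  | empty => simpa using! Lp.coeFn_zero ℝ 2 volΩ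
  | insert i s hi ih =>
    rw [Finset.sum_insert hi]
    filter_upwards [Lp.coeFn_add (v i) (∑ i ∈ s, v i), ih] with x h1 h2
    rw [h1, Pi.add_apply, h2, Finset.sum_insert hi]

/-- The Volterra operator is the norm limit of the finite rank operators that replace `prim p` by
its values at the left end points of the intervals `[i/n, (i+1)/n)`. -/
theorem isCompactOperator_volterraJ : IsCompactOperator volterraJ := by
  -- the point evaluation `p ↦ prim p c`
  set ev : ℝ → L2 →L[ℝ] ℝ := fun c => -innerSL ℝ (ind c 1) with hev
  have hevp : ∀ c ∈ Icc (0 : ℝ) 1, ∀ p, ev c p = prim p c := by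
    intro c hc p
    simp only [hev, neg_apply, innerSL_apply_apply]
    rw [inner_ind hc.1 hc.2 le_rfl, prim, intervalIntegral.integral_symm, neg_neg]
  set e : ℕ → ℕ → L2 := fun n i => indicatorConstLp 2
    (measurableSet_Ico : MeasurableSet (Ico ((i : ℝ) / n) ((i + 1) / n)))
    (measure_ne_top volΩ _) 1 with he
  set F : ℕ → L2 →L[ℝ] L2 := fun n => ∑ i ∈ Finset.range n, (ev (i / n)).smulRight (e n i) with hF
  have hFc : ∀ n, IsCompactOperator (F n) := by
    intro n
    have : F n ∈ compactOperator (RingHom.id ℝ) L2 L2 := by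
      refine Submodule.sum_mem _ fun i _ => ?_
      have h1 : IsCompactOperator (ContinuousLinearMap.toSpanSingleton ℝ (e n i)) :=
        isCompactOperator_of_locallyCompactSpace_rng _
      exact h1.comp_clm (ev ((i : ℝ) / n))
    exact this
  have hbd : ∀ n : ℕ, 0 < n → ‖F n - volterraJ‖ ≤ √(1 / n) := by
    intro n hn
    have hn' : (0 : ℝ) < n := Nat.cast_pos.2 hn
    refine ContinuousLinearMap.opNorm_le_bound _ (Real.sqrt_nonneg _) fun p => ?_
    refine norm_L2_le_of_ae (by positivity) ?_
    have hFp : F n p = ∑ i ∈ Finset.range n, ev (i / n) p • e n i := by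
      simp [hF]
    rw [sub_apply, hFp]
    have hterm : ∀ᵐ x ∂volΩ, ∀ i : ℕ, (ev (i / n) p • e n i : L2) x
        = ev (i / n) p * (Ico ((i : ℝ) / n) ((i + 1) / n)).indicator (fun _ => (1 : ℝ)) x := by
      rw [ae_all_iff]
      intro i
      have h6 : ⇑(e n i) =ᵐ[volΩ] (Ico ((i : ℝ) / n) ((i + 1) / n)).indicator fun _ => (1 : ℝ) :=
        indicatorConstLp_coeFn
      filter_upwards [Lp.coeFn_smul (ev (i / n) p) (e n i), h6] with x h1 h2
      rw [h1, Pi.smul_apply, h2, smul_eq_mul]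
    filter_upwards [Lp.coeFn_sub (∑ i ∈ Finset.range n, ev (i / n) p • e n i) (volterraJ p),
      coeFn_L2_sum (Finset.range n) (fun i => ev (i / n) p • e n i), hterm,
      represents_volterraJ p, ae_restrict_mem measurableSet_Ioo] with x h1 h2 h3 h4 hx
    have hnx : 0 ≤ n * x := mul_nonneg hn'.le hx.1.le
    set k := ⌊n * x⌋₊ with hk
    have hk1 : (k : ℝ) / n ≤ x := by
      rw [div_le_iff₀ hn', mul_comm]; exact Nat.floor_le hnx
    have hk2 : x < ((k : ℝ) + 1) / n := by
      rw [lt_div_iff₀ hn', mul_comm]; exact Nat.lt_floor_add_one _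
    have hkn : k < n := by
      rw [hk, Nat.floor_lt hnx]
      nlinarith [hx.2]
    have hsum : ∑ i ∈ Finset.range n, (ev (i / n) p • e n i : L2) x = prim p (k / n) := by
      rw [Finset.sum_eq_single k, h3 k, indicator_of_mem (mem_Ico.2 ⟨hk1, hk2⟩), mul_one,
        hevp _ ⟨by positivity, hk1.trans hx.2.le⟩]
      · intro i _ hik
        rw [h3 i, indicator_of_notMem, mul_zero]
        rintro ⟨h5, h6⟩
        refine hik ?_
        rw [div_le_iff₀ hn', mul_comm] at h5
        rw [lt_div_iff₀ hn', mul_comm] at h6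
        exact ((Nat.floor_eq_iff hnx).2 ⟨h5, h6⟩).symm
      · intro h; exact absurd (Finset.mem_range.2 hkn) h
    rw [h1, Pi.sub_apply, h2, hsum, h4, abs_sub_comm]
    refine (abs_prim_sub_prim_le p (by positivity) hk1 hx.2.le).trans
      (mul_le_mul_of_nonneg_right (Real.sqrt_le_sqrt ?_) (norm_nonneg _))
    rw [add_div] at hk2
    linarith
  refine isCompactOperator_of_tendsto (l := atTop) (F := F) ?_ (Eventually.of_forall hFc)
  rw [tendsto_iff_norm_sub_tendsto_zero]
  have h0 : Tendsto (fun n : ℕ => √(1 / (n : ℝ))) atTop (𝓝 0) := by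
    have := (Real.continuous_sqrt.tendsto 0).comp (tendsto_one_div_atTop_nhds_zero_nat (𝕜 := ℝ))
    rwa [Real.sqrt_zero] at this
  refine squeeze_zero' (Eventually.of_forall fun n => norm_nonneg _) ?_ h0
  exact (eventually_gt_atTop 0).mono fun n hn => hbd n hn

/-! ### The inverse of the elliptic operator -/

/-- The assumptions on the coefficients that the spectral theory of `A` depends on. -/
structure AdmissibleCoeff (a q : ℝ → ℝ) (a₀ : ℝ) : Prop where
  continuousOn : ContinuousOn a (Icc 0 1)
  pos : 0 < a₀
  lower : ∀ x ∈ Icc (0 : ℝ) 1, a₀ ≤ a x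
  memLp : MemLp q ⊤ volΩ
  nonneg : ∀ᵐ x ∂volΩ, 0 ≤ q x

/-- Multiplication by a bounded function on `L²(Ω)`. -/
noncomputable def mulOp (m : ℝ → ℝ) (hm : MemLp m ⊤ volΩ) : L2 →L[ℝ] L2 :=
  (ContinuousLinearMap.mul ℝ ℝ).holderL volΩ ⊤ 2 2 (hm.toLp m)

theorem represents_mulOp {m : ℝ → ℝ} (hm : MemLp m ⊤ volΩ) {v : L2} {V : ℝ → ℝ}
    (hv : Represents V v) : Represents (fun x => m x * V x) (mulOp m hm v) := by
  have h : ⇑(mulOp m hm v) =ᵐ[volΩ] fun x => hm.toLp m x * v x :=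
    (ContinuousLinearMap.mul ℝ ℝ).coeFn_holder (r := 2) (hm.toLp m) v
  filter_upwards [h, hm.coeFn_toLp, hv] with x h1 h2 h3
  rw [h1, h2, h3]

theorem Represents.add {v w : L2} {V W : ℝ → ℝ} (hv : Represents V v) (hw : Represents W w) :
    Represents (fun x => V x + W x) (v + w) := by
  filter_upwards [Lp.coeFn_add v w, hv, hw] with x h1 h2 h3
  rw [h1, Pi.add_apply, h2, h3]

theorem Represents.sub {v w : L2} {V W : ℝ → ℝ} (hv : Represents V v) (hw : Represents W w) :
    Represents (fun x => V x - W x) (v - w) := by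
  filter_upwards [Lp.coeFn_sub v w, hv, hw] with x h1 h2 h3
  rw [h1, Pi.sub_apply, h2, h3]

theorem Represents.neg {v : L2} {V : ℝ → ℝ} (hv : Represents V v) :
    Represents (fun x => -V x) (-v) := by
  filter_upwards [Lp.coeFn_neg v, hv] with x h1 h2
  rw [h1, Pi.neg_apply, h2]

theorem Represents.smul {v : L2} {V : ℝ → ℝ} (c : ℝ) (hv : Represents V v) :
    Represents (fun x => c * V x) (c • v) := by
  filter_upwards [Lp.coeFn_smul c v, hv] with x h1 h2
  rw [h1, Pi.smul_apply, h2, smul_eq_mul]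

theorem Represents.ae_eq {v : L2} {V W : ℝ → ℝ} (hv : Represents V v) (hw : Represents W v) :
    V =ᵐ[volΩ] W := by
  filter_upwards [hv, hw] with x h1 h2
  rw [← h1, h2]

theorem inner_mulOp_comm {m : ℝ → ℝ} (hm : MemLp m ⊤ volΩ) (v w : L2) :
    inner ℝ (mulOp m hm v) w = inner ℝ v (mulOp m hm w) := by
  rw [inner_eq_integral_of_represents (represents_mulOp hm (.self v)) (.self w),
    inner_eq_integral_of_represents (.self v) (represents_mulOp hm (.self w))]
  congr 1; ext x; ring

theorem le_inner_mulOp {m : ℝ → ℝ} (hm : MemLp m ⊤ volΩ) {c : ℝ} (hc : ∀ᵐ x ∂volΩ, c ≤ m x)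
    (v : L2) : c * ‖v‖ ^ 2 ≤ inner ℝ (mulOp m hm v) v := by
  rw [← real_inner_self_eq_norm_sq, ← real_inner_smul_left, ← sub_nonneg, ← inner_sub_left,
    MeasureTheory.L2.inner_def]
  refine integral_nonneg_of_ae ?_
  filter_upwards [(represents_mulOp hm (.self v)).sub ((Represents.self v).smul c), hc] with x h1 h2
  rw [h1]
  simp only [RCLike.inner_apply, Pi.zero_apply, conj_trivial]
  nlinarith [mul_nonneg (sub_nonneg.2 h2) (mul_self_nonneg (v x))]

namespace AdmissibleCoeff

variable {a q : ℝ → ℝ} {a₀ : ℝ} (h : AdmissibleCoeff a q a₀)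

theorem memLp_a (h : AdmissibleCoeff a q a₀) : MemLp a ⊤ volΩ :=
  memLp_of_continuousOn h.continuousOn ⊤

/-- The operator of the energy form `∫ a v' w' + q v w`, for functions `v`, `w` that vanish at `1`,
written in terms of the derivatives `p = v'`: with `v = J p` it is `M_a + J† M_q J`. -/
noncomputable def energyOp : L2 →L[ℝ] L2 :=
  mulOp a h.memLp_a
    + (ContinuousLinearMap.adjoint volterraJ).comp ((mulOp q h.memLp).comp volterraJ)

theorem energyOp_apply (p : L2) : h.energyOp p = mulOp a h.memLp_a p
    + ContinuousLinearMap.adjoint volterraJ (mulOp q h.memLp (volterraJ p)) := rfl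

theorem inner_energyOp_comm (p r : L2) :
    inner ℝ (h.energyOp p) r = inner ℝ p (h.energyOp r) := by
  rw [energyOp_apply, energyOp_apply, inner_add_left, inner_add_right, inner_mulOp_comm,
    ContinuousLinearMap.adjoint_inner_left, ContinuousLinearMap.adjoint_inner_right,
    inner_mulOp_comm]

theorem le_inner_energyOp (p : L2) : a₀ * ‖p‖ ^ 2 ≤ inner ℝ (h.energyOp p) p := by
  rw [energyOp_apply, inner_add_left, ContinuousLinearMap.adjoint_inner_left]
  have h1 := le_inner_mulOp h.memLp_a (ae_volΩ_of_forall h.lower) p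
  have h2 := le_inner_mulOp h.memLp h.nonneg (volterraJ p)
  linarith

theorem isUnit_energyOp : IsUnit h.energyOp := by
  refine ContinuousLinearMap.isUnit_of_forall_le_norm_inner_map h.energyOp
    (c := ⟨a₀, h.pos.le⟩) h.pos fun p => ?_
  rw [mul_comm]
  exact (h.le_inner_energyOp p).trans (le_abs_self _)

/-- The derivative `v'` of the solution of `Av = w`. -/
noncomputable def derivOp : L2 →L[ℝ] L2 :=
  (Ring.inverse h.energyOp).comp (ContinuousLinearMap.adjoint volterraJ)

/-- The inverse `w ↦ v` of the operator `A`. -/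
noncomputable def solOp : L2 →L[ℝ] L2 := volterraJ.comp h.derivOp

theorem solOp_apply (w : L2) : h.solOp w = volterraJ (h.derivOp w) := rfl

theorem energyOp_derivOp (w : L2) :
    h.energyOp (h.derivOp w) = ContinuousLinearMap.adjoint volterraJ w :=
  congrArg (fun T : L2 →L[ℝ] L2 => T (ContinuousLinearMap.adjoint volterraJ w))
    (Ring.mul_inverse_cancel _ h.isUnit_energyOp)

theorem derivOp_eq {p w : L2} (hp : h.energyOp p = ContinuousLinearMap.adjoint volterraJ w) :
    h.derivOp w = p := by
  have h1 := congrArg (fun T : L2 →L[ℝ] L2 => T p)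
    (Ring.inverse_mul_cancel _ h.isUnit_energyOp)
  have h2 : Ring.inverse h.energyOp (h.energyOp p) = p := h1
  rwa [hp] at h2

theorem represents_energyOp (p : L2) : Represents
    (fun x => a x * p x + -∫ y in (0 : ℝ)..x, mulOp q h.memLp (volterraJ p) y) (h.energyOp p) :=
  (represents_mulOp h.memLp_a (.self p)).add (represents_adjoint_volterraJ _)

theorem integral_flux (w : L2) {v : L2} {V : ℝ → ℝ} (hV : Represents V v) {x : ℝ}
    (hx : x ∈ Icc (0 : ℝ) 1) :
    ∫ y in (0 : ℝ)..x, ((-w : L2) y + q y * V y)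
      = (∫ y in (0 : ℝ)..x, mulOp q h.memLp v y) - ∫ y in (0 : ℝ)..x, w y := by
  rw [← intervalIntegral.integral_sub (L2.intervalIntegrable _ zero_mem_Icc01 hx)
    (L2.intervalIntegrable _ zero_mem_Icc01 hx)]
  refine integral_congr_volΩ ?_ zero_mem_Icc01 hx
  filter_upwards [represents_mulOp h.memLp hV, (Represents.self w).neg] with y h1 h2
  rw [h1, h2]; ring

/-- `solOp` is the inverse of `A`. -/
theorem operatorA_iff {v w : L2} : OperatorA a q v w ↔ v = h.solOp w := by
  have ha0 : ∀ x ∈ Icc (0 : ℝ) 1, a x ≠ 0 := fun x hx => (h.pos.trans_le (h.lower x hx)).ne'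
  have hflux : ∀ v : L2, ContinuousOn (fun x => ((∫ y in (0 : ℝ)..x, mulOp q h.memLp v y)
      - ∫ y in (0 : ℝ)..x, w y) / a x) (Icc 0 1) := fun v =>
    ((continuousOn_primitive _ zero_mem_Icc01).sub (continuousOn_primitive _ zero_mem_Icc01)).div
      h.continuousOn ha0
  constructor
  · rintro ⟨V, V', hV, hE, hV0, hV1⟩
    have hV'eq : ∀ x ∈ Icc (0 : ℝ) 1, V' x = ((∫ y in (0 : ℝ)..x, mulOp q h.memLp v y)
        - ∫ y in (0 : ℝ)..x, w y) / a x := by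
      intro x hx
      rw [eq_div_iff (ha0 x hx), ← h.integral_flux w hV hx, mul_comm, hE.flux x hx, hV0, mul_zero,
        zero_add]
    have hV'c : ContinuousOn V' (Icc 0 1) := (hflux v).congr hV'eq
    have hmem := memLp_of_continuousOn hV'c 2
    set p : L2 := hmem.toLp with hp
    have hpV : Represents V' p := hmem.coeFn_toLp
    have hprim : ∀ x ∈ Icc (0 : ℝ) 1, prim p x = V x := by
      intro x hx
      have h1 : ∫ y in x..1, V' y = V 1 - V x := by
        refine intervalIntegral.integral_eq_sub_of_hasDerivAt_of_le hx.2 ?_ ?_ ?_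
        · exact fun y hy => ((hE.hasDeriv y ⟨hx.1.trans hy.1, hy.2⟩).continuousWithinAt).mono
            (Icc_subset_Icc_left hx.1)
        · exact fun y hy => (hE.hasDeriv y ⟨hx.1.trans hy.1.le, hy.2.le⟩).hasDerivAt
            (Icc_mem_nhds (hx.1.trans_lt hy.1) hy.2)
        · exact (hV'c.mono (uIcc_subset_Icc hx one_mem_Icc01)).intervalIntegrable
      rw [prim, integral_congr_volΩ hpV one_mem_Icc01 hx, intervalIntegral.integral_symm, h1, hV1]
      ring
    have hvJ : v = volterraJ p := by
      refine hV.eq ?_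
      filter_upwards [represents_volterraJ p, ae_volΩ_of_forall hprim] with x h1 h2
      rw [h1, h2]
    rw [h.solOp_apply, hvJ]
    congr 1
    refine (h.derivOp_eq ((h.represents_energyOp p).eq ?_)).symm
    filter_upwards [represents_adjoint_volterraJ w, hpV, ae_volΩ_of_forall hV'eq,
      ae_volΩ_of_forall ha0] with x h1 h2 h3 h4
    rw [h1, h2, h3, ← hvJ, mul_div_cancel₀ _ h4]
    ring
  · intro hv
    set p := h.derivOp w with hp
    have hvp : v = volterraJ p := hv
    -- the continuous representative of `p`, read off from the equation for the flux
    set V' : ℝ → ℝ := fun x => ((∫ y in (0 : ℝ)..x, mulOp q h.memLp v y)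
      - ∫ y in (0 : ℝ)..x, w y) / a x with hV'
    have hpV : Represents V' p := by
      have h1 := (h.energyOp_derivOp w ▸ h.represents_energyOp p).ae_eq
        (represents_adjoint_volterraJ w)
      filter_upwards [h1, ae_volΩ_of_forall ha0] with x h2 h3
      simp only [hV']
      rw [eq_div_iff h3, hvp]
      linarith
    have hrep : Represents (prim V') v := by
      rw [hvp]
      filter_upwards [represents_volterraJ p, ae_volΩ_of_forall fun x hx =>
        integral_congr_volΩ hpV one_mem_Icc01 hx] with x h1 h2
      rw [h1]; exact h2
    have hV'0 : V' 0 = 0 := by simp [hV']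
    refine ⟨prim V', V', hrep, ⟨fun x hx => ?_, fun x hx => ?_⟩, hV'0, prim_one _⟩
    · exact hasDerivWithinAt_primitive (hflux v) one_mem_Icc01 hx
    · rw [h.integral_flux w hrep hx, hV'0, mul_zero, zero_add, hV', mul_div_cancel₀ _ (ha0 x hx)]

theorem inner_solOp_comm (v w : L2) : inner ℝ (h.solOp v) w = inner ℝ v (h.solOp w) := by
  rw [solOp_apply, solOp_apply, ← ContinuousLinearMap.adjoint_inner_right,
    ← ContinuousLinearMap.adjoint_inner_left volterraJ, ← energyOp_derivOp h w,
    ← energyOp_derivOp h v, inner_energyOp_comm]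

theorem isCompactOperator_solOp : IsCompactOperator h.solOp :=
  isCompactOperator_volterraJ.comp_clm h.derivOp

/-- Coercivity: `a₀ ‖v'‖² ≤ (Av, v)`, written with `w = Av`. -/
theorem norm_derivOp_sq_le (w : L2) : a₀ * ‖h.derivOp w‖ ^ 2 ≤ inner ℝ w (h.solOp w) := by
  refine (h.le_inner_energyOp _).trans_eq ?_
  rw [energyOp_derivOp, ContinuousLinearMap.adjoint_inner_left, solOp_apply]

theorem inner_solOp_nonneg (w : L2) : 0 ≤ inner ℝ w (h.solOp w) :=
  (mul_nonneg h.pos.le (sq_nonneg _)).trans (h.norm_derivOp_sq_le w)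

/-- `A` is single-valued: its inverse is injective. -/
theorem eq_zero_of_solOp_eq_zero {w : L2} (hw : h.solOp w = 0) : w = 0 := by
  have h1 := h.norm_derivOp_sq_le w
  rw [hw, inner_zero_right] at h1
  have h2 : ‖h.derivOp w‖ ^ 2 ≤ 0 := by
    by_contra! h3
    exact absurd h1 (not_le.2 (mul_pos h.pos h3))
  have h3 : h.derivOp w = 0 := by
    rw [← norm_eq_zero]; exact pow_eq_zero_iff two_ne_zero |>.1 (le_antisymm h2 (sq_nonneg _))
  have h4 := h.energyOp_derivOp w
  rw [h3, map_zero] at h4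
  have h5 : EqOn (fun x => -∫ y in (0 : ℝ)..x, w y) (fun _ => 0) (Icc 0 1) := by
    refine Measure.eqOn_Icc_of_ae_eq volume zero_ne_one ?_
      (continuousOn_primitive w zero_mem_Icc01).neg continuousOn_const
    rw [← restrict_Ioo_eq_restrict_Icc]
    exact (h4 ▸ represents_adjoint_volterraJ w).ae_eq (Lp.coeFn_zero ℝ 2 volΩ)
  refine Lp.ext (EventuallyEq.trans ?_ (Lp.coeFn_zero ℝ 2 volΩ).symm)
  have h6 := (w.intervalIntegrable zero_mem_Icc01 one_mem_Icc01).ae_hasDerivAt_integral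
  filter_upwards [ae_restrict_of_ae h6, ae_restrict_mem measurableSet_Ioo] with x h7 hx
  rw [uIcc_of_le zero_le_one] at h7
  have h8 := h7 (Ioo_subset_Icc_self hx) 0 zero_mem_Icc01
  have h9 : (fun x => ∫ y in (0 : ℝ)..x, w y) =ᶠ[𝓝 x] fun _ => 0 :=
    (Ioo_mem_nhds hx.1 hx.2 |> Filter.eventually_of_mem <| fun y hy =>
      neg_eq_zero.1 (h5 (Ioo_subset_Icc_self hy)))
  exact (h8.congr_of_eventuallyEq h9.symm).unique (hasDerivAt_const x 0)

/-- A function `v` with `‖Av‖ ≤ Λ ‖v‖` is bounded by a multiple of `Λ^{1/4} ‖v‖`. -/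
theorem exists_sup_bound {w : L2} {Λ : ℝ} (hΛ₀ : 0 ≤ Λ) (hΛ : ‖w‖ ≤ Λ * ‖h.solOp w‖) :
    ∃ V : ℝ → ℝ, ContinuousOn V (Icc 0 1) ∧ Represents V (h.solOp w) ∧
      ∀ x ∈ Icc (0 : ℝ) 1, |V x| ≤ √(2 * √(Λ / a₀)) * ‖h.solOp w‖ := by
  refine ⟨prim (h.derivOp w), continuousOn_prim _, represents_volterraJ _, fun x hx => ?_⟩
  set v := h.solOp w with hv
  have h1 := prim_sq_le (h.derivOp w) hx
  rw [← h.solOp_apply, ← hv] at h1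
  have h2 : ‖h.derivOp w‖ ≤ √(Λ / a₀) * ‖v‖ := by
    have h3 : a₀ * ‖h.derivOp w‖ ^ 2 ≤ Λ * ‖v‖ ^ 2 :=
      calc _ ≤ inner ℝ w v := h.norm_derivOp_sq_le w
        _ ≤ ‖w‖ * ‖v‖ := real_inner_le_norm _ _
        _ ≤ Λ * ‖v‖ * ‖v‖ := mul_le_mul_of_nonneg_right hΛ (norm_nonneg _)
        _ = _ := by ring
    refine le_of_sq_le_sq ?_ (by positivity)
    rw [mul_pow, Real.sq_sqrt (div_nonneg hΛ₀ h.pos.le), div_mul_eq_mul_div, le_div_iff₀ h.pos]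
    linarith
  refine abs_le_of_sq_le_sq ?_ (by positivity)
  rw [mul_pow, Real.sq_sqrt (by positivity)]
  nlinarith [mul_le_mul_of_nonneg_left h2 (norm_nonneg v)]

end AdmissibleCoeff

/-! ### Spectral decomposition -/

namespace AdmissibleCoeff

variable {a q : ℝ → ℝ} {a₀ : ℝ} (h : AdmissibleCoeff a q a₀)

theorem mem_eigenspace_iff {lam : ℝ} {φ : L2} :
    φ ∈ eigenspace a q lam ↔ φ = lam • h.solOp φ := by
  -- the closed subspace of all solutions of `φ = lam K φ`
  set S : Submodule ℝ L2 := (ContinuousLinearMap.id ℝ L2 - lam • h.solOp).ker with hS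
  have hSmem : ∀ ψ : L2, ψ ∈ S ↔ ψ = lam • h.solOp ψ := fun ψ => by
    rw [hS, LinearMap.mem_ker]
    exact sub_eq_zero
  have hset : {φ : L2 | OperatorA a q φ (lam • φ)} = (S : Set L2) := by
    ext ψ
    rw [mem_ofPred_eq, SetLike.mem_coe, hSmem, h.operatorA_iff, map_smul]
  have hcl : IsClosed (S : Set L2) :=
    (ContinuousLinearMap.id ℝ L2 - lam • h.solOp).isClosed_ker
  rw [← hSmem, eigenspace, hset, Submodule.span_eq, hcl.submodule_topologicalClosure_eq]

/-- Symmetry of `A` in the form `(Aφ, v) = (φ, Av)` for an eigenfunction `φ`, with `w = Av`. -/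
theorem inner_eigenvector {lam : ℝ} {φ : L2} (hφ : φ ∈ eigenspace a q lam) (w : L2) :
    inner ℝ φ w = lam * inner ℝ φ (h.solOp w) := by
  conv_lhs => rw [h.mem_eigenspace_iff.1 hφ]
  rw [real_inner_smul_left, inner_solOp_comm]

theorem orthogonalFamily_eigenspace (h : AdmissibleCoeff a q a₀) :
    OrthogonalFamily ℝ (fun lam => eigenspace a q lam)
      fun lam => (eigenspace a q lam).subtypeₗᵢ := by
  rintro lam mu hne ⟨φ, hφ⟩ ⟨ψ, hψ⟩
  show inner ℝ φ ψ = 0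
  have h1 := h.inner_eigenvector hφ ψ
  have h2 := h.inner_eigenvector hψ φ
  have c1 : inner ℝ ψ φ = inner ℝ φ ψ := real_inner_comm _ _
  have c2 : inner ℝ ψ (h.solOp φ) = inner ℝ φ (h.solOp ψ) := by
    rw [← inner_solOp_comm, real_inner_comm]
  rw [c1, c2] at h2
  have h3 : (lam - mu) * inner ℝ φ ψ = 0 := by
    linear_combination lam * h2 - mu * h1
  exact (mul_eq_zero.1 h3).resolve_left (sub_ne_zero.2 hne)

/-- The eigenfunctions of `A` are complete in `L²(Ω)`. -/
theorem iSup_eigenspace_orthogonal (h : AdmissibleCoeff a q a₀) :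
    (⨆ lam, eigenspace a q lam)ᗮ = ⊥ := by
  have h1 := ContinuousLinearMap.orthogonalComplement_iSup_eigenspaces_eq_bot
    h.isCompactOperator_solOp (T := h.solOp) (fun v w => h.inner_solOp_comm v w)
  rw [eq_bot_iff, ← h1]
  refine Submodule.orthogonal_le (iSup_le fun mu => ?_)
  rcases eq_or_ne mu 0 with rfl | hmu
  · intro φ hφ
    rw [Module.End.mem_eigenspace_iff, zero_smul] at hφ
    rw [h.eq_zero_of_solOp_eq_zero hφ]
    exact Submodule.zero_mem _
  · refine le_trans (fun φ hφ => ?_) (le_iSup (fun lam => eigenspace a q lam) mu⁻¹)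
    rw [Module.End.mem_eigenspace_iff] at hφ
    rw [h.mem_eigenspace_iff]
    have h2 : h.solOp φ = mu • φ := hφ
    rw [h2, smul_smul, inv_mul_cancel₀ hmu, one_smul]

/-- A positive lower bound of the spectrum of `A`. -/
noncomputable def specBound : ℝ := 1 / (‖h.solOp‖ + 1)

theorem specBound_pos : 0 < h.specBound := by unfold specBound; positivity

theorem specBound_le {lam : ℝ} {φ : L2} (hφ : φ ∈ eigenspace a q lam) (hne : φ ≠ 0) :
    h.specBound ≤ lam := by
  have hn : 0 < ‖φ‖ := norm_pos_iff.2 hne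
  have hpos : 0 < lam := by
    by_contra! hlam
    have h1 := h.inner_eigenvector hφ φ
    rw [real_inner_self_eq_norm_sq] at h1
    nlinarith [h.inner_solOp_nonneg φ, sq_pos_of_pos hn]
  have h2 : ‖φ‖ ≤ lam * (‖h.solOp‖ * ‖φ‖) := by
    conv_lhs => rw [h.mem_eigenspace_iff.1 hφ, norm_smul, Real.norm_of_nonneg hpos.le]
    exact mul_le_mul_of_nonneg_left (h.solOp.le_opNorm φ) hpos.le
  rw [specBound, div_le_iff₀ (by positivity)]
  have h3 : 1 * ‖φ‖ ≤ (lam * ‖h.solOp‖) * ‖φ‖ := by linarith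
  linarith [le_of_mul_le_mul_right h3 hn]

/-- Spectral projections vanish below `specBound`. -/
theorem proj_eq_zero {lam : ℝ} (hlam : lam < h.specBound) (v : L2) :
    (eigenspace a q lam).starProjection v = 0 := by
  by_contra hne
  exact absurd (h.specBound_le (Submodule.starProjection_apply_mem _ v) hne) (not_le.2 hlam)

theorem hasSum_proj (h : AdmissibleCoeff a q a₀) (v : L2) :
    HasSum (fun lam => (eigenspace a q lam).starProjection v) v :=
  have : ∀ lam, CompleteSpace (eigenspace a q lam) := fun _ =>
    (Submodule.isClosed_topologicalClosure _).completeSpace_coe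
  hasSum_starProjection h.orthogonalFamily_eigenspace h.iSup_eigenspace_orthogonal v

theorem ext_proj (h : AdmissibleCoeff a q a₀) {v w : L2}
    (hvw : ∀ lam, (eigenspace a q lam).starProjection v
    = (eigenspace a q lam).starProjection w) : v = w := by
  have h1 := h.hasSum_proj v
  simp_rw [hvw] at h1
  exact h1.unique (h.hasSum_proj w)

theorem summable_norm_sq_proj (h : AdmissibleCoeff a q a₀) (v : L2) :
    Summable fun lam => ‖(eigenspace a q lam).starProjection v‖ ^ 2 :=
  (hasSum_norm_sq_of_hasSum h.orthogonalFamily_eigenspace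
    (fun _ => Submodule.starProjection_apply_mem _ v) (h.hasSum_proj v)).summable

/-- If `∑ (lam c(lam))² ‖P_lam v‖² < ∞`, the series `∑ lam c(lam) P_lam v` is mapped to
`∑ c(lam) P_lam v` by the inverse of `A`. -/
theorem solOp_multiplier {c : ℝ → ℝ} {v w x : L2}
    (hw : HasSum (fun lam => (lam * c lam) • (eigenspace a q lam).starProjection v) w)
    (hx : HasSum (fun lam => c lam • (eigenspace a q lam).starProjection v) x) :
    h.solOp w = x := by
  have h1 := hw.mapL h.solOp
  refine h1.unique ?_
  convert! hx using 2 with lam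
  have h2 := h.mem_eigenspace_iff.1
    (Submodule.starProjection_apply_mem (eigenspace a q lam) v)
  conv_rhs => rw [h2]
  rw [map_smul, smul_smul, mul_comm]

/-- Comparison of fractional norms: a bound between the spectral components of `v` and `w` only has
to be checked on the spectrum of `A`. -/
theorem fracDomain_of_le {s σ B : ℝ} {v w : L2} (hw : w ∈ fracDomain a q s)
    (hle : ∀ lam, h.specBound ≤ lam →
      lam ^ (2 * σ) * ‖(eigenspace a q lam).starProjection v‖ ^ 2
        ≤ B * (lam ^ (2 * s) * ‖(eigenspace a q lam).starProjection w‖ ^ 2)) :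
    v ∈ fracDomain a q σ ∧
      ∑' lam : ℝ, lam ^ (2 * σ) * ‖(eigenspace a q lam).starProjection v‖ ^ 2
        ≤ B * ∑' lam : ℝ, lam ^ (2 * s) * ‖(eigenspace a q lam).starProjection w‖ ^ 2 := by
  have hs : Summable fun lam : ℝ =>
      B * (lam ^ (2 * s) * ‖(eigenspace a q lam).starProjection w‖ ^ 2) := Summable.mul_left B hw
  have hle' : ∀ lam, lam ^ (2 * σ) * ‖(eigenspace a q lam).starProjection v‖ ^ 2
        ≤ B * (lam ^ (2 * s) * ‖(eigenspace a q lam).starProjection w‖ ^ 2) := by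
    intro lam
    rcases lt_or_ge lam h.specBound with hlt | hge
    · rw [h.proj_eq_zero hlt, h.proj_eq_zero hlt]; simp
    · exact hle lam hge
  have hsum : v ∈ fracDomain a q σ := by
    refine Summable.of_nonneg_of_le (fun lam => ?_) hle' hs
    rcases lt_or_ge lam h.specBound with hlt | hge
    · rw [h.proj_eq_zero hlt]; simp
    · exact mul_nonneg (Real.rpow_nonneg (h.specBound_pos.le.trans hge) _) (sq_nonneg _)
  refine ⟨hsum, ?_⟩
  rw [← tsum_mul_left]
  exact Summable.tsum_le_tsum hle' hsum hs

/-! ### Point values of functions in the domain of a fractional power -/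

/-- On a dyadic block `[Λ, 2Λ)` of the spectrum, the Sobolev inequality bounds the maximum by
`Λ^{1/4}` times the `L²`-norm. -/
theorem exists_block (h : AdmissibleCoeff a q a₀) {σ Λ : ℝ} (hσ : 0 < σ) (hΛ : 0 < Λ)
    {v : L2} (hv : v ∈ fracDomain a q σ) :
    ∃ (x : L2) (V : ℝ → ℝ), ContinuousOn V (Icc 0 1) ∧ Represents V x ∧
      (∀ lam, (eigenspace a q lam).starProjection x
        = (Ico Λ (2 * Λ)).indicator (fun _ => (1 : ℝ)) lam • (eigenspace a q lam).starProjection v) ∧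
      ∀ t ∈ Icc (0 : ℝ) 1, |V t| ≤ √(2 * √(2 * Λ / a₀)) * (Λ ^ (-σ) *
        √(∑' lam : ℝ, lam ^ (2 * σ) * ‖(eigenspace a q lam).starProjection v‖ ^ 2)) := by
  set χ : ℝ → ℝ := (Ico Λ (2 * Λ)).indicator fun _ => (1 : ℝ) with hχ
  set P : ℝ → ℝ := fun lam => ‖(eigenspace a q lam).starProjection v‖ ^ 2 with hP
  have hχ01 : ∀ lam, (lam ∈ Ico Λ (2 * Λ) ∧ χ lam = 1) ∨ χ lam = 0 := fun lam => by
    by_cases hm : lam ∈ Ico Λ (2 * Λ)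
    · exact Or.inl ⟨hm, indicator_of_mem hm _⟩
    · exact Or.inr (indicator_of_notMem hm _)
  have hP0 : ∀ lam, 0 ≤ P lam := fun lam => sq_nonneg _
  have hsP : Summable P := h.summable_norm_sq_proj v
  have hs1 : Summable fun lam => χ lam ^ 2 * P lam := by
    refine Summable.of_nonneg_of_le (fun lam => by have := hP0 lam; positivity) (fun lam => ?_) hsP
    rcases hχ01 lam with ⟨-, h1⟩ | h1 <;> simp [h1, hP0 lam]
  have hle2 : ∀ lam, (lam * χ lam) ^ 2 * P lam ≤ (2 * Λ) ^ 2 * (χ lam ^ 2 * P lam) := by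
    intro lam
    rcases hχ01 lam with ⟨hm, h1⟩ | h1
    · rw [h1, mul_one, one_pow, one_mul]
      exact mul_le_mul_of_nonneg_right (pow_le_pow_left₀ (hΛ.le.trans hm.1) hm.2.le 2) (hP0 lam)
    · simp [h1]
  have hs2 : Summable fun lam => (lam * χ lam) ^ 2 * P lam :=
    Summable.of_nonneg_of_le (fun lam => by have := hP0 lam; positivity) hle2 (hs1.mul_left _)
  obtain ⟨x, hx1, hx2, hx3⟩ := exists_hasSum_multiplier h.orthogonalFamily_eigenspace χ v hs1
  obtain ⟨w, hw1, -, hw3⟩ := exists_hasSum_multiplier h.orthogonalFamily_eigenspace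
    (fun lam => lam * χ lam) v hs2
  have hKw : h.solOp w = x := h.solOp_multiplier hw1 hx1
  have hwx : ‖w‖ ≤ 2 * Λ * ‖x‖ := by
    refine le_of_sq_le_sq ?_ (by positivity)
    rw [mul_pow, hw3, hx3, ← tsum_mul_left]
    exact Summable.tsum_le_tsum hle2 hs2 (hs1.mul_left _)
  have hxN : ‖x‖ ≤ Λ ^ (-σ) * √(∑' lam : ℝ, lam ^ (2 * σ) * P lam) := by
    have hN : 0 ≤ ∑' lam : ℝ, lam ^ (2 * σ) * P lam := tsum_nonneg fun lam => by
      rcases lt_or_ge lam h.specBound with hlt | hge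
      · simp [hP, h.proj_eq_zero hlt]
      · exact mul_nonneg (Real.rpow_nonneg (h.specBound_pos.le.trans hge) _) (hP0 lam)
    refine le_of_sq_le_sq ?_ (by positivity)
    rw [mul_pow, Real.sq_sqrt hN, hx3, ← tsum_mul_left]
    refine Summable.tsum_le_tsum (fun lam => ?_) hs1 (Summable.mul_left _ hv)
    have hpow : (Λ ^ (-σ)) ^ 2 = (Λ ^ (2 * σ))⁻¹ := by
      rw [← Real.rpow_natCast, ← Real.rpow_mul hΛ.le, ← Real.rpow_neg hΛ.le]
      congr 1; push_cast; ring
    rcases hχ01 lam with ⟨hm, h1⟩ | h1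
    · rw [h1, one_pow, one_mul, ← mul_assoc]
      refine le_mul_of_one_le_left (hP0 lam) ?_
      rw [hpow, inv_mul_eq_div, one_le_div (Real.rpow_pos_of_pos hΛ _)]
      exact Real.rpow_le_rpow hΛ.le hm.1 (by positivity)
    · rw [h1]
      rcases lt_or_ge lam h.specBound with hlt | hge
      · simp [hP, h.proj_eq_zero hlt]
      · rw [zero_pow two_ne_zero, zero_mul]
        exact mul_nonneg (sq_nonneg _)
          (mul_nonneg (Real.rpow_nonneg (h.specBound_pos.le.trans hge) _) (hP0 lam))
  obtain ⟨V, hVc, hVr, hVb⟩ := h.exists_sup_bound (w := w) (Λ := 2 * Λ) (by positivity)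
    (by rw [hKw]; exact hwx)
  rw [hKw] at hVr hVb
  exact ⟨x, V, hVc, hVr, hx2, fun t ht => (hVb t ht).trans
    (mul_le_mul_of_nonneg_left hxN (Real.sqrt_nonneg _))⟩

end AdmissibleCoeff

theorem tendsto_of_tendstoUniformlyOn {s : ℕ → L2} {v : L2} {F : ℕ → ℝ → ℝ} {V : ℝ → ℝ}
    (hs : ∀ n, Represents (F n) (s n)) (hv : Represents V v)
    (hF : TendstoUniformlyOn F V atTop (Icc 0 1)) : Tendsto s atTop (𝓝 v) := by
  rw [Metric.tendsto_atTop]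
  intro ε hε
  obtain ⟨N, hN⟩ := eventually_atTop.1 (Metric.tendstoUniformlyOn_iff.1 hF (ε / 2) (half_pos hε))
  refine ⟨N, fun n hn => ?_⟩
  rw [dist_eq_norm]
  refine lt_of_le_of_lt (norm_L2_le_of_ae (half_pos hε).le ?_) (half_lt_self hε)
  filter_upwards [(hs n).sub hv, ae_volΩ_of_forall (hN n hn)] with x h1 h2
  rw [h1, ← Real.dist_eq, dist_comm]
  exact h2.le

theorem Represents.sum {ι : Type*} (s : Finset ι) {v : ι → L2} {V : ι → ℝ → ℝ}
    (hv : ∀ i, Represents (V i) (v i)) :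
    Represents (fun x => ∑ i ∈ s, V i x) (∑ i ∈ s, v i) := by
  classical
  induction s using Finset.induction_on with
  | empty => simp [Represents]
  | insert i s hi ih =>
    simp_rw [Finset.sum_insert hi]
    exact (hv i).add ih

namespace AdmissibleCoeff

variable {a q : ℝ → ℝ} {a₀ : ℝ} (h : AdmissibleCoeff a q a₀)

/-- For `σ > 1/4`, the domain of `A^σ` is continuously embedded into the continuous functions: the
bounds for the dyadic blocks form a convergent geometric series with ratio `2^{1/4-σ}`. -/
theorem exists_continuous_rep (h : AdmissibleCoeff a q a₀) {σ : ℝ} (hσ : 1 / 4 < σ) :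
    ∃ C : ℝ, ∀ v ∈ fracDomain a q σ, ∃ V : ℝ → ℝ, ContinuousOn V (Icc 0 1) ∧ Represents V v ∧
      ∀ t ∈ Icc (0 : ℝ) 1, |V t| ≤ C *
        √(∑' lam : ℝ, lam ^ (2 * σ) * ‖(eigenspace a q lam).starProjection v‖ ^ 2) := by
  set m := h.specBound with hm
  have hm0 : 0 < m := h.specBound_pos
  set ρ : ℝ := 2 ^ (1 / 4 - σ) with hρ
  have hρ0 : 0 < ρ := by positivity
  have hρ1 : ρ < 1 := Real.rpow_lt_one_of_one_lt_of_neg one_lt_two (by linarith)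
  set D : ℝ := √(2 * √(2 * m / a₀)) * m ^ (-σ) with hD
  have ha₀ := h.pos
  have hconst : ∀ k : ℕ, √(2 * √(2 * (m * 2 ^ k) / a₀)) * (m * 2 ^ k) ^ (-σ) = D * ρ ^ k := by
    intro k
    have h2k : (0 : ℝ) ≤ 2 ^ k := by positivity
    have e1 : √(2 * √(2 * (m * 2 ^ k) / a₀)) = √(2 * √(2 * m / a₀)) * ((2 : ℝ) ^ k) ^ (1 / 4 : ℝ) := by
      rw [show 2 * (m * 2 ^ k) / a₀ = (2 * m / a₀) * 2 ^ k by ring,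
        Real.sqrt_mul (show 0 ≤ 2 * m / a₀ by positivity), ← mul_assoc,
        Real.sqrt_mul (show 0 ≤ 2 * √(2 * m / a₀) by positivity)]
      congr 1
      rw [Real.sqrt_eq_rpow, Real.sqrt_eq_rpow, ← Real.rpow_mul h2k]
      norm_num
    have e2 : ((2 : ℝ) ^ k) ^ (1 / 4 : ℝ) * ((2 : ℝ) ^ k) ^ (-σ) = ρ ^ k := by
      rw [← Real.rpow_add (by positivity), hρ, ← Real.rpow_natCast, ← Real.rpow_natCast,
        ← Real.rpow_mul zero_le_two, ← Real.rpow_mul zero_le_two]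
      congr 1; ring
    rw [e1, Real.mul_rpow hm0.le h2k, hD, ← e2]
    ring
  have hgeom : Summable fun k : ℕ => ρ ^ k := summable_geometric_of_lt_one hρ0.le hρ1
  refine ⟨D * (1 - ρ)⁻¹, fun v hv => ?_⟩
  set N := √(∑' lam : ℝ, lam ^ (2 * σ) * ‖(eigenspace a q lam).starProjection v‖ ^ 2) with hN
  choose x V hVc hVr hVp hVb using fun k : ℕ =>
    h.exists_block (σ := σ) (Λ := m * 2 ^ k) (by linarith) (by positivity) hv
  have hVb' : ∀ k, ∀ t ∈ Icc (0 : ℝ) 1, ‖V k t‖ ≤ D * ρ ^ k * N := by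
    intro k t ht
    rw [← hconst k, mul_assoc]
    exact hVb k t ht
  have hbs : Summable fun k : ℕ => D * ρ ^ k * N := (hgeom.mul_left D).mul_right N
  have hcont : ContinuousOn (fun t => ∑' k, V k t) (Icc 0 1) := continuousOn_tsum hVc hbs hVb'
  have hrep := (memLp_of_continuousOn hcont 2).coeFn_toLp
  set v' : L2 := (memLp_of_continuousOn hcont 2).toLp with hv'
  have htend : Tendsto (fun n => ∑ k ∈ Finset.range n, x k) atTop (𝓝 v') :=
    tendsto_of_tendstoUniformlyOn (fun n => Represents.sum (Finset.range n) hVr) hrep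
      (tendstoUniformlyOn_tsum_nat hbs hVb')
  -- the sum of the blocks is `v`, since both have the same spectral projections
  have hvv' : v' = v := by
    refine h.ext_proj fun lam => ?_
    have h1 := ((eigenspace a q lam).starProjection.continuous.tendsto v').comp htend
    refine tendsto_nhds_unique h1 ?_
    have h2 : HasSum (fun k => (eigenspace a q lam).starProjection (x k))
        ((eigenspace a q lam).starProjection v) := by
      simp_rw [hVp]
      rcases lt_or_ge lam m with hlt | hge
      · rw [h.proj_eq_zero hlt]
        simp
      · obtain ⟨k, hk1, hk2⟩ := exists_nat_pow_near ((one_le_div hm0).2 hge) one_lt_two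
        rw [le_div_iff₀ hm0, mul_comm] at hk1
        rw [div_lt_iff₀ hm0] at hk2
        have hmem : lam ∈ Ico (m * 2 ^ k) (2 * (m * 2 ^ k)) :=
          ⟨hk1, hk2.trans_eq (by rw [pow_succ]; ring)⟩
        have h3 := hasSum_single (f := fun k => (Ico (m * 2 ^ k) (2 * (m * 2 ^ k))).indicator
          (fun _ => (1 : ℝ)) lam • (eigenspace a q lam).starProjection v) k ?_
        · rwa [indicator_of_mem hmem, one_smul] at h3
        · intro j hj
          rw [indicator_of_notMem, zero_smul]
          rintro ⟨hj1, hj2⟩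
          have l1 : (2 : ℝ) ^ j < 2 ^ (k + 1) := by
            refine lt_of_mul_lt_mul_left (hj1.trans_lt (hk2.trans_eq (mul_comm _ _))) hm0.le
          have l2 : (2 : ℝ) ^ k < 2 ^ (j + 1) := by
            refine lt_of_mul_lt_mul_left (hk1.trans_lt (hj2.trans_eq ?_)) hm0.le
            rw [pow_succ]; ring
          have l3 := (pow_lt_pow_iff_right₀ (one_lt_two (α := ℝ))).1 l1
          have l4 := (pow_lt_pow_iff_right₀ (one_lt_two (α := ℝ))).1 l2
          omega
    have h3 := h2.tendsto_sum_nat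
    simp_rw [← map_sum] at h3
    exact h3
  refine ⟨_, hcont, hvv' ▸ hrep, fun t ht => ?_⟩
  have h1 := tsum_of_norm_bounded ((hasSum_geometric_of_lt_one hρ0.le hρ1).mul_left D |>.mul_right N)
    (fun k => hVb' k t ht)
  exact h1

end AdmissibleCoeff

theorem HasValueAtZero.add {v w : L2} {c d : ℝ} (hv : HasValueAtZero v c)
    (hw : HasValueAtZero w d) : HasValueAtZero (v + w) (c + d) := by
  obtain ⟨V, hV1, hV2, rfl⟩ := hv
  obtain ⟨W, hW1, hW2, rfl⟩ := hw
  exact ⟨_, hV1.add hW1, hV2.add hW2, rfl⟩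

theorem HasValueAtZero.smul {v : L2} {c : ℝ} (b : ℝ) (hv : HasValueAtZero v c) :
    HasValueAtZero (b • v) (b * c) := by
  obtain ⟨V, hV1, hV2, rfl⟩ := hv
  exact ⟨_, hV1.const_mul b, hV2.smul b, rfl⟩

theorem HasValueAtZero.unique {v : L2} {c d : ℝ} (hv : HasValueAtZero v c)
    (hw : HasValueAtZero v d) : c = d := by
  obtain ⟨V, hV1, hV2, rfl⟩ := hv
  obtain ⟨W, hW1, hW2, rfl⟩ := hw
  refine Measure.eqOn_Icc_of_ae_eq volume zero_ne_one ?_ hV1 hW1 zero_mem_Icc01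
  rw [← restrict_Ioo_eq_restrict_Icc]
  exact hV2.ae_eq hW2

namespace AdmissibleCoeff

variable {a q : ℝ → ℝ} {a₀ : ℝ} (h : AdmissibleCoeff a q a₀)

theorem exists_value_at_zero (h : AdmissibleCoeff a q a₀) {σ : ℝ} (hσ : 1 / 4 < σ) :
    ∃ C : ℝ, ∀ v ∈ fracDomain a q σ, ∃ c, HasValueAtZero v c ∧
      |c| ≤ C * √(∑' lam : ℝ, lam ^ (2 * σ) * ‖(eigenspace a q lam).starProjection v‖ ^ 2) := by
  obtain ⟨C, hC⟩ := h.exists_continuous_rep hσ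
  refine ⟨C, fun v hv => ?_⟩
  obtain ⟨V, h1, h2, h3⟩ := hC v hv
  exact ⟨V 0, ⟨V, h1, h2, rfl⟩, h3 0 zero_mem_Icc01⟩

theorem add_mem_fracDomain (h : AdmissibleCoeff a q a₀) {s : ℝ} {v w : L2}
    (hv : v ∈ fracDomain a q s) (hw : w ∈ fracDomain a q s) : v + w ∈ fracDomain a q s := by
  have hsum := (Summable.mul_left 2 hv).add (Summable.mul_left 2 hw)
  refine Summable.of_norm_bounded hsum fun lam => ?_
  rcases lt_or_ge lam h.specBound with hlt | hge
  · simp [h.proj_eq_zero hlt]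
  · have h0 := Real.rpow_nonneg (h.specBound_pos.le.trans hge) (2 * s)
    have h1 := norm_add_le ((eigenspace a q lam).starProjection v)
      ((eigenspace a q lam).starProjection w)
    have h2 := pow_le_pow_left₀ (norm_nonneg _) h1 2
    have h3 := h2.trans (add_sq_le (a := ‖(eigenspace a q lam).starProjection v‖))
    rw [Real.norm_of_nonneg (mul_nonneg h0 (sq_nonneg _)), map_add]
    nlinarith [mul_le_mul_of_nonneg_left h3 h0]

theorem mem_fracDomain_of_norm_le (h : AdmissibleCoeff a q a₀) {s : ℝ} {v w : L2}
    (hw : w ∈ fracDomain a q s) (hle : ∀ lam, ‖(eigenspace a q lam).starProjection v‖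
      ≤ ‖(eigenspace a q lam).starProjection w‖) : v ∈ fracDomain a q s := by
  refine (h.fracDomain_of_le (σ := s) (B := 1) hw fun lam hlam => ?_).1
  rw [one_mul]
  exact mul_le_mul_of_nonneg_left (pow_le_pow_left₀ (norm_nonneg _) (hle lam) 2)
    (Real.rpow_nonneg (h.specBound_pos.le.trans hlam) _)

/-- `D(A^{1+s}) ⊆ D(A)` for `s ≥ 0`, and `A` maps `D(A^{1+s})` into `D(A^s)`. -/
theorem exists_operatorA {s : ℝ} (hs : 0 ≤ s) {v : L2} (hv : v ∈ fracDomain a q (1 + s)) :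
    ∃ w, v = h.solOp w ∧ w ∈ fracDomain a q s := by
  have hm := h.specBound_pos
  have hsum : Summable fun lam : ℝ => lam ^ 2 * ‖(eigenspace a q lam).starProjection v‖ ^ 2 := by
    refine Summable.of_nonneg_of_le (fun lam => by positivity) (fun lam => ?_)
      (Summable.mul_left (h.specBound ^ (-(2 * s))) hv)
    rcases lt_or_ge lam h.specBound with hlt | hge
    · simp [h.proj_eq_zero hlt]
    · have hlam := hm.trans_le hge
      rw [← mul_assoc]
      refine mul_le_mul_of_nonneg_right ?_ (sq_nonneg _)
      have e : lam ^ (2 * (1 + s)) = lam ^ 2 * lam ^ (2 * s) := by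
        rw [mul_add, mul_one, Real.rpow_add hlam, Real.rpow_two]
      have h1 : 1 ≤ h.specBound ^ (-(2 * s)) * lam ^ (2 * s) := by
        rw [Real.rpow_neg hm.le, inv_mul_eq_div, one_le_div (Real.rpow_pos_of_pos hm _)]
        exact Real.rpow_le_rpow hm.le hge (by positivity)
      rw [e]
      nlinarith [mul_le_mul_of_nonneg_left h1 (sq_nonneg lam)]
  obtain ⟨w, hw1, hw2, -⟩ := exists_hasSum_multiplier h.orthogonalFamily_eigenspace
    (fun lam => lam) v hsum
  refine ⟨w, ?_, ?_⟩
  · refine (h.solOp_multiplier (c := fun _ => 1) (v := v) (w := w) ?_ ?_).symm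
    · simpa using hw1
    · simpa using h.hasSum_proj v
  · refine (h.fracDomain_of_le (σ := s) (B := 1) hv fun lam hlam => ?_).1
    have hlam' := hm.trans_le hlam
    rw [hw2, norm_smul, mul_pow, Real.norm_eq_abs, sq_abs, one_mul, ← mul_assoc, mul_add, mul_one,
      Real.rpow_add hlam', Real.rpow_two, mul_comm (lam ^ 2)]

/-! ### The solution in the eigenspaces -/

/-- As long as the boundary excitation vanishes, the equation in the eigenspace at `lam` is the
scalar equation `∂ₜ^α y + lam y = (f - A u₀, φ)` for `y = (u - u₀, φ)`. -/
theorem modal_equation {α T T₁ : ℝ} (hα : α ∈ Ioo (0 : ℝ) 1) (hT : T₁ ≤ T) {g : ℝ → ℝ}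
    (hg : ∀ t ∈ Ioc (0 : ℝ) T₁, g t = 0) {f u₀ Au₀ : L2} (hAu₀ : u₀ = h.solOp Au₀)
    {u : ℝ → L2} (hu : IsSolution a q α T g f u₀ u) {lam : ℝ} {φ : L2}
    (hφ : φ ∈ eigenspace a q lam) {t : ℝ} (ht : t ∈ Icc 0 T₁) :
    (Real.Gamma (1 - α))⁻¹ * ∫ s in (0 : ℝ)..t, (t - s) ^ (-α) * inner ℝ φ (u s - u₀)
      = ∫ s in (0 : ℝ)..t, (inner ℝ φ (f - Au₀) - lam * inner ℝ φ (u s - u₀)) := by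
  obtain ⟨w, ⟨hwint, hw⟩, hae⟩ := hu.equation
  have htT : t ∈ Icc 0 T := ⟨ht.1, ht.2.trans hT⟩
  have h1 := congrArg (innerSL ℝ φ) (hw t htT)
  have hcont : ContinuousOn (fun s => u s - u 0) (uIcc 0 t) := by
    rw [uIcc_of_le ht.1]
    exact (hu.continuousOn.mono (Icc_subset_Icc_right htT.2)).sub continuousOn_const
  have hi1 : IntervalIntegrable (fun s => (t - s) ^ (-α) • (u s - u 0)) volume 0 t :=
    (intervalIntegrable_sub_rpow (by linarith [hα.2]) t 0 t).smul_continuousOn hcont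
  have hi2 : IntervalIntegrable w volume 0 t := by
    rw [intervalIntegrable_iff_integrableOn_Ioc_of_le ht.1]
    exact hwint.mono_set (Ioc_subset_Ioc_right htT.2)
  rw [map_smul, ← ContinuousLinearMap.intervalIntegral_comp_comm _ hi1,
    ← ContinuousLinearMap.intervalIntegral_comp_comm _ hi2] at h1
  simp only [map_smul, innerSL_apply_apply, smul_eq_mul, hu.initial] at h1
  rw [h1]
  refine intervalIntegral.integral_congr_ae ?_
  filter_upwards [(ae_restrict_iff' measurableSet_Ioc).1 hae] with s hs hst
  rw [uIoc_of_le ht.1] at hst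
  obtain ⟨V, V', hV, hE, hbc, hV1⟩ := hs ⟨hst.1, hst.2.trans htT.2⟩
  rw [hg s ⟨hst.1, hst.2.trans ht.2⟩, neg_eq_zero, mul_eq_zero] at hbc
  have hV'0 : V' 0 = 0 :=
    hbc.resolve_left (h.pos.trans_le (h.lower 0 zero_mem_Icc01)).ne'
  have hop : u s = h.solOp (f - w s) :=
    h.operatorA_iff.1 ⟨V, V', hV, by rwa [neg_sub], hV'0, hV1⟩
  have h2 := h.inner_eigenvector hφ (f - w s)
  have h3 := h.inner_eigenvector hφ Au₀
  rw [← hop] at h2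
  rw [← hAu₀] at h3
  simp only [inner_sub_right] at h2 ⊢
  linarith

/-- The remainder `u(t) - u₀ - t^α/Γ(1+α) (f - A u₀)` in the eigenspace at `lam`. -/
theorem norm_proj_remainder_le {α T T₁ : ℝ} (hα : α ∈ Ioo (0 : ℝ) 1) (hT₁ : 0 < T₁) (hT : T₁ ≤ T)
    {g : ℝ → ℝ} (hg : ∀ t ∈ Ioc (0 : ℝ) T₁, g t = 0) {f u₀ Au₀ : L2} (hAu₀ : u₀ = h.solOp Au₀)
    {u : ℝ → L2} (hu : IsSolution a q α T g f u₀ u) {θ : ℝ} (hθ : θ ∈ Icc (0 : ℝ) 1)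
    {t : ℝ} (ht : t ∈ Icc 0 T₁) {lam : ℝ} (hlam : 0 ≤ lam) :
    ‖(eigenspace a q lam).starProjection
        (u t - u₀ - (t ^ α / Real.Gamma (1 + α)) • (f - Au₀))‖
      ≤ t ^ α / Real.Gamma (1 + α) * (lam * (t ^ α / Real.Gamma (1 + α))) ^ θ
        * ‖(eigenspace a q lam).starProjection (f - Au₀)‖ := by
  set A := t ^ α / Real.Gamma (1 + α) with hA
  have hA0 : 0 ≤ A := div_nonneg (Real.rpow_nonneg ht.1 _)
    (Real.Gamma_pos_of_pos (by linarith [hα.1])).le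
  set e := u t - u₀ - A • (f - Au₀) with he
  set φ := (eigenspace a q lam).starProjection e with hφdef
  have hφ : φ ∈ eigenspace a q lam := Submodule.starProjection_apply_mem _ _
  have hproj : ∀ v : L2, inner ℝ φ v = inner ℝ φ ((eigenspace a q lam).starProjection v) := by
    intro v
    rw [← Submodule.inner_starProjection_left_eq_right, Submodule.starProjection_eq_self_iff.2 hφ]
  have hy : ContinuousOn (fun s => inner ℝ φ (u s - u₀)) (Icc 0 T₁) :=
    continuousOn_const.inner
      ((hu.continuousOn.mono (Icc_subset_Icc_right hT)).sub continuousOn_const)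
  -- test the equation with the projection of the remainder itself
  have hest := mode_estimate hα hT₁ hlam hy
    (fun t ht => h.modal_equation hα hT hg hAu₀ hu hφ ht) hθ ht
  rw [← hA] at hest
  have h1 : inner ℝ φ (u t - u₀) - inner ℝ φ (f - Au₀) * A = ‖φ‖ ^ 2 := by
    rw [← real_inner_self_eq_norm_sq]
    have h0 : inner ℝ φ φ = inner ℝ φ e := (hproj e).symm
    rw [h0, he, inner_sub_right φ (u t - u₀), real_inner_smul_right]
    ring
  rw [h1, abs_of_nonneg (sq_nonneg _)] at hest
  have h2 : |inner ℝ φ (f - Au₀)| ≤ ‖φ‖ * ‖(eigenspace a q lam).starProjection (f - Au₀)‖ := by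
    rw [hproj]
    exact abs_real_inner_le_norm _ _
  set b := A * (lam * A) ^ θ with hb
  have hb0 : 0 ≤ b := mul_nonneg hA0 (Real.rpow_nonneg (mul_nonneg hlam hA0) _)
  have h3 : ‖φ‖ * ‖φ‖ ≤ ‖φ‖ * (b * ‖(eigenspace a q lam).starProjection (f - Au₀)‖) := by
    have := mul_le_mul_of_nonneg_right h2 hb0
    rw [mul_assoc, ← hb] at hest
    nlinarith
  rcases (norm_nonneg φ).eq_or_lt with h0 | h0
  · rw [← h0]; positivity
  · exact le_of_mul_le_mul_left h3 h0

/-- The remainder lies in `D(A^σ)` and is `O(t^{α(1+θ)})` there when `f - A u₀ ∈ D(A^{σ+θ})`. -/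
theorem remainder_mem_fracDomain {α T T₁ : ℝ} (hα : α ∈ Ioo (0 : ℝ) 1) (hT₁ : 0 < T₁)
    (hT : T₁ ≤ T) {g : ℝ → ℝ} (hg : ∀ t ∈ Ioc (0 : ℝ) T₁, g t = 0) {f u₀ Au₀ : L2}
    (hAu₀ : u₀ = h.solOp Au₀) {u : ℝ → L2} (hu : IsSolution a q α T g f u₀ u) {θ σ : ℝ}
    (hθ : θ ∈ Icc (0 : ℝ) 1) (hr : f - Au₀ ∈ fracDomain a q (σ + θ)) {t : ℝ} (ht : t ∈ Icc 0 T₁) :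
    u t - u₀ - (t ^ α / Real.Gamma (1 + α)) • (f - Au₀) ∈ fracDomain a q σ ∧
      √(∑' lam : ℝ, lam ^ (2 * σ) * ‖(eigenspace a q lam).starProjection
          (u t - u₀ - (t ^ α / Real.Gamma (1 + α)) • (f - Au₀))‖ ^ 2)
        ≤ (t ^ α / Real.Gamma (1 + α)) ^ (1 + θ) * √(∑' lam : ℝ,
          lam ^ (2 * (σ + θ)) * ‖(eigenspace a q lam).starProjection (f - Au₀)‖ ^ 2) := by
  have hbound := fun lam (hlam : 0 ≤ lam) =>
    h.norm_proj_remainder_le hα hT₁ hT hg hAu₀ hu hθ ht hlam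
  set A := t ^ α / Real.Gamma (1 + α) with hA
  have hA0 : 0 ≤ A := div_nonneg (Real.rpow_nonneg ht.1 _)
    (Real.Gamma_pos_of_pos (by linarith [hα.1])).le
  have hB : A ^ (1 + θ) = A * A ^ θ := by
    rw [Real.rpow_add' hA0 (by linarith [hθ.1]), Real.rpow_one]
  obtain ⟨h1, h2⟩ := h.fracDomain_of_le (σ := σ) (B := (A ^ (1 + θ)) ^ 2) hr
    (v := u t - u₀ - A • (f - Au₀)) fun lam hlam => by
      have hl := h.specBound_pos.trans_le hlam
      have h3 := pow_le_pow_left₀ (norm_nonneg _) (hbound lam hl.le) 2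
      have h4 := mul_le_mul_of_nonneg_left h3 (Real.rpow_nonneg hl.le (2 * σ))
      refine h4.trans_eq ?_
      have e : lam ^ (2 * (σ + θ)) = lam ^ (2 * σ) * (lam ^ θ) ^ 2 := by
        rw [mul_add, Real.rpow_add hl, ← Real.rpow_natCast (lam ^ θ), ← Real.rpow_mul hl.le,
          Nat.cast_ofNat, mul_comm θ]
      rw [e, hB, Real.mul_rpow hl.le hA0]
      ring
  refine ⟨h1, ?_⟩
  have h5 := Real.sqrt_le_sqrt h2
  rwa [Real.sqrt_mul (sq_nonneg _), Real.sqrt_sq (Real.rpow_nonneg hA0 _)] at h5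

end AdmissibleCoeff

end Subdiffusion

/-! ### The expansion at the left end point -/

open Subdiffusion in
theorem proposition4p1
    (a q : ℝ → ℝ) (a₀ : ℝ)
    (ha : ContDiffOn ℝ 2 a (Icc 0 1)) (ha₀ : 0 < a₀) (ha_lower : ∀ x ∈ Icc (0 : ℝ) 1, a₀ ≤ a x)
    (hq : MemLp q ⊤ ((volume : Measure ℝ).restrict (Ioo (0 : ℝ) 1)))
    (hq_nonneg : ∀ᵐ x ∂((volume : Measure ℝ).restrict (Ioo (0 : ℝ) 1)), 0 ≤ q x)
    (α : ℝ) (hα : α ∈ Ioo (0 : ℝ) 1)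
    (T T₁ : ℝ) (hT₁ : 0 < T₁) (hT : T₁ ≤ T)
    (g : ℝ → ℝ) (hg : ∀ t ∈ Ioc (0 : ℝ) T₁, g t = 0)
    (s : ℝ) (hs : s ∈ Ioc (1 / 4 : ℝ) (5 / 4))
    (u₀ f : L2) (hu₀ : u₀ ∈ fracDomain a q (1 + s)) (hf : f ∈ fracDomain a q s)
    (u : ℝ → L2) (hu : IsSolution a q α T g f u₀ u) :
    ∃ (Au₀ : L2) (c₀ c₁ c₂ : ℝ) (h : ℝ → ℝ),
      OperatorA a q u₀ Au₀ ∧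
      HasValueAtZero u₀ c₀ ∧ HasValueAtZero (-Au₀) c₁ ∧ HasValueAtZero f c₂ ∧
      (∀ t ∈ Ioc (0 : ℝ) T₁, HasValueAtZero (u t) (h t)) ∧
      ∀ ε ∈ Ioo (0 : ℝ) (s - 1 / 4),
        (fun t : ℝ => h t - (c₀ + (c₁ + c₂) / Real.Gamma (1 + α) * t ^ α))
          =O[𝓝[>] 0] fun t : ℝ => t ^ ((1 - 1 / 4 - ε / 2 + s) * α) := by
  have hc : AdmissibleCoeff a q a₀ := ⟨ha.continuousOn, ha₀, ha_lower, hq, hq_nonneg⟩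
  have hΓ : 0 < Real.Gamma (1 + α) := Real.Gamma_pos_of_pos (by linarith [hα.1])
  obtain ⟨Au₀, hAu₀, hAs⟩ := hc.exists_operatorA (by linarith [hs.1]) hu₀
  have hnAs : -Au₀ ∈ fracDomain a q s :=
    hc.mem_fracDomain_of_norm_le hAs fun lam => by rw [map_neg, norm_neg]
  have hrs : f - Au₀ ∈ fracDomain a q s := by
    rw [sub_eq_add_neg]
    exact hc.add_mem_fracDomain hf hnAs
  obtain ⟨C₀, hC₀⟩ := hc.exists_value_at_zero (show 1 / 4 < 1 + s by linarith [hs.1])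
  obtain ⟨Cs, hCs⟩ := hc.exists_value_at_zero hs.1
  obtain ⟨c₀, hc₀, -⟩ := hC₀ u₀ hu₀
  obtain ⟨c₁, hc₁, -⟩ := hCs (-Au₀) hnAs
  obtain ⟨c₂, hc₂, -⟩ := hCs f hf
  -- the value of the remainder at the end point is of the order asserted
  have key : ∀ ε ∈ Ioo (0 : ℝ) (s - 1 / 4), ∃ C : ℝ, ∀ t ∈ Ioc (0 : ℝ) T₁, ∃ c : ℝ,
      HasValueAtZero (u t) (c₀ + (c₁ + c₂) / Real.Gamma (1 + α) * t ^ α + c) ∧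
      |c| ≤ C * t ^ ((1 - 1 / 4 - ε / 2 + s) * α) := by
    intro ε hε
    -- `σ = 1/4 + ε/2` is large enough for point values; `θ` is the rest of the smoothness `s`
    set θ := s - 1 / 4 - ε / 2 with hθdef
    have hθ : θ ∈ Icc (0 : ℝ) 1 := ⟨by linarith [hε.1, hε.2], by linarith [hε.1, hs.2]⟩
    obtain ⟨C, hC⟩ := hc.exists_value_at_zero (show 1 / 4 < 1 / 4 + ε / 2 by linarith [hε.1])
    have hr : f - Au₀ ∈ fracDomain a q (1 / 4 + ε / 2 + θ) := by
      rwa [show 1 / 4 + ε / 2 + θ = s by rw [hθdef]; ring]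
    refine ⟨|C| * ((Real.Gamma (1 + α) ^ (1 + θ))⁻¹ * √(∑' lam : ℝ,
      lam ^ (2 * (1 / 4 + ε / 2 + θ)) * ‖(eigenspace a q lam).starProjection (f - Au₀)‖ ^ 2)),
      fun t ht => ?_⟩
    obtain ⟨hmem, hbd⟩ :=
      hc.remainder_mem_fracDomain hα hT₁ hT hg hAu₀ hu hθ hr ⟨ht.1.le, ht.2⟩
    obtain ⟨c, hc, hcb⟩ := hC _ hmem
    refine ⟨c, ?_, ?_⟩
    · have h1 := (hc₀.add ((hc₁.add hc₂).smul (t ^ α / Real.Gamma (1 + α)))).add hc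
      convert! h1 using 1
      · rw [neg_add_eq_sub]; abel
      · ring
    · have hexp : (t ^ α / Real.Gamma (1 + α)) ^ (1 + θ)
          = (Real.Gamma (1 + α) ^ (1 + θ))⁻¹ * t ^ ((1 - 1 / 4 - ε / 2 + s) * α) := by
        rw [Real.div_rpow (Real.rpow_nonneg ht.1.le _) hΓ.le, ← Real.rpow_mul ht.1.le,
          div_eq_inv_mul]
        congr 2
        rw [hθdef]; ring
      rw [hexp] at hbd
      calc |c| ≤ |C| * _ :=
            hcb.trans (mul_le_mul_of_nonneg_right (le_abs_self C) (Real.sqrt_nonneg _))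
        _ ≤ _ := mul_le_mul_of_nonneg_left hbd (abs_nonneg C)
        _ = _ := by ring
  have hex : ∀ t : ℝ, ∃ c : ℝ, t ∈ Ioc (0 : ℝ) T₁ → HasValueAtZero (u t) c := by
    intro t
    by_cases ht : t ∈ Ioc (0 : ℝ) T₁
    · obtain ⟨C, hC⟩ := key ((s - 1 / 4) / 2) ⟨by linarith [hs.1], by linarith [hs.1]⟩
      obtain ⟨c, hc, -⟩ := hC t ht
      exact ⟨_, fun _ => hc⟩
    · exact ⟨0, fun h => absurd h ht⟩
  choose h hh using hex
  refine ⟨Au₀, c₀, c₁, c₂, h, hc.operatorA_iff.2 hAu₀, hc₀, hc₁, hc₂, hh, fun ε hε => ?_⟩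
  obtain ⟨C, hC⟩ := key ε hε
  refine IsBigO.of_bound C ?_
  filter_upwards [Ioc_mem_nhdsGT hT₁] with t ht
  obtain ⟨c, hval, hcb⟩ := hC t ht
  rw [(hh t ht).unique hval, add_sub_cancel_left, Real.norm_eq_abs,
    Real.norm_of_nonneg (Real.rpow_nonneg ht.1.le _)]
  exact hcb
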